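/- Let $\Bbbk$ be a field; all vector spaces, algebras (associative, unital) and coalgebras (coassociative, counital) are over $\Bbbk$, and Sweedler notation $\Delta(x)=x_1\otimes x_2$ is used. A *Yetter–Drinfeld (YD) post-Hopf algebra* $(H,\rightharpoonup)=(H,\cdot,1,\Delta,\epsilon,S,\rightharpoonup)$ consists of an algebra $(H,\cdot,1)$, a coalgebra $(H,\Delta,\epsilon)$, a linear map $S:H\to H$ with $x_1\cdot S(x_2)=S(x_1)\cdot x_2=\epsilon(x)1$, and a coalgebra morphism $\rightharpoonup:H\otimes H\to H$ such that for all $x,y,z\in H$: 1. $x\rightharpoonup(y\cdot z)=(x_1\rightharpoonup y)\cdot(x_2\rightharpoonup z)$ and $x\rightharpoonup(y\rightharpoonup z)=\big(x_1\cdot(x_2\rightharpoonup y)\big)\rightharpoonup z$; 2. the map $\alpha:H\to\mathrm{End}(H)$, $\alpha(x)(y)=x\rightharpoonup y$, has a (necessarily unique) convolution inverse $\beta:H\to\mathrm{End}(H)$, i.e. $\alpha(x_1)\circ\beta(x_2)=\beta(x_1)\circ\alpha(x_2)=\epsilon(x)\mathrm{Id}_H$; 3. $\epsilon(x\cdot y)=\epsilon(x)\epsilon(y)$,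 $\epsilon(1)=1$, $\Delta(1)=1\otimes 1$ and $\Delta(x\cdot y)=\big(x_1\cdot\alpha(x_2)(\beta(x_4)(y_1))\big)\otimes(x_3\cdot y_2)$; 4. setting $x\bullet_\rightharpoonup y:=x_1\cdot(x_2\rightharpoonup y)$, $S_\rightharpoonup(x):=\beta(x_1)(S(x_2))$ and $$x\leftharpoonup y:=S_\rightharpoonup(x_1\rightharpoonup y_1)\bullet_\rightharpoonup x_2\bullet_\rightharpoonup y_2, \qquad(\ast)$$ one has $\Delta(S_\rightharpoonup(x))=S_\rightharpoonup(x_2)\otimes S_\rightharpoonup(x_1)$ and $(x_1\rightharpoonup y_1)\otimes(x_2\leftharpoonup y_2)=(x_2\rightharpoonup y_2)\otimes(x_1\leftharpoonup y_1)$. A morphism of YD post-Hopf algebras is a morphism $g$ of algebras and of coalgebras with $g(x\rightharpoonup y)=g(x)\rightharpoonup' g(y)$. A *matched pair of actions* $(H,\rightharpoonup,\leftharpoonup)$ on a Hopf algebra $H=(H,\bullet,1,\Delta,\epsilon,T)$ consists of a left action $\rightharpoonup$ and a right action $\leftharpoonup$ of $H$ on itself making $H$ a left and a right $H$-module coalgebra,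 such that for all $a,b,c\in H$: $a\rightharpoonup 1=\epsilon(a)1$, $1\leftharpoonup a=\epsilon(a)1$, $a\rightharpoonup(b\bullet c)=(a_1\rightharpoonup b_1)\bullet((a_2\leftharpoonup b_2)\rightharpoonup c)$, $(a\bullet b)\leftharpoonup c=(a\leftharpoonup(b_1\rightharpoonup c_1))\bullet(b_2\leftharpoonup c_2)$ and $a\bullet b=(a_1\rightharpoonup b_1)\bullet(a_2\leftharpoonup b_2)$. A morphism of matched pairs of actions is a bialgebra morphism that commutes with both actions. **Statement.** The category of YD post-Hopf algebras over $\Bbbk$ and the category of matched pairs of actions on Hopf algebras over $\Bbbk$ are isomorphic: there are mutually inverse functors between them, which leave the underlying coalgebra $(H,\Delta,\epsilon)$ of an object and the underlying map of a morphism unchanged. Explicitly, the first functor sends $(H,\cdot,1,\Delta,\epsilon,S,\rightharpoonup)$ to the matched pair of actions $(H_\rightharpoonup,\rightharpoonup,\leftharpoonup)$ on the Hopf algebra $H_\rightharpoonup=(H,\bullet_\rightharpoonup,1,\Delta,\epsilon,S_\rightharpoonup)$, with $\leftharpoonup$ given by $(\ast)$. The second sends a matched pair of actions $(H,\rightharpoonup,\leftharpoonup)$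 on a Hopf algebra $(H,\bullet,1,\Delta,\epsilon,T)$ to the YD post-Hopf algebra $(H,\cdot,1,\Delta,\epsilon,S,\rightharpoonup)$ with $a\cdot b=a_1\bullet(T(a_2)\rightharpoonup b)$ and $S(a)=a_1\rightharpoonup T(a_2)$. -/

import Mathlib

open CategoryTheory TensorProduct

universe v u

namespace YDPostHopf

noncomputable section

section Operations

variable {k : Type u} {H : Type v} [Field k] [Ring H] [Algebra k H] [Coalgebra k H]

/-- `x ⊗ y ↦ x • y := x₁ · (x₂ ⇀ y)`, for a linear map `act : x ⊗ y ↦ x ⇀ y`. -/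
def bullet (act : H ⊗[k] H →ₗ[k] H) : H ⊗[k] H →ₗ[k] H :=
  LinearMap.mul' k H ∘ₗ act.lTensor H ∘ₗ (TensorProduct.assoc k H H H).toLinearMap ∘ₗ
    (Coalgebra.comul (R := k) (A := H)).rTensor H

/-- `x ↦ β x₁ (S x₂)`. -/
def subAntipode (β : H →ₗ[k] Module.End k H) (S : H →ₗ[k] H) : H →ₗ[k] H :=
  TensorProduct.lift (β.compl₂ S) ∘ₗ Coalgebra.comul

/-- `x ⊗ y ↦ x ↼ y := S' (x₁ ⇀ y₁) • (x₂ • y₂)`, where `S' x = β x₁ (S x₂)`. The comultiplication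
of `H ⊗ H` is `x ⊗ y ↦ (x₁ ⊗ y₁) ⊗ (x₂ ⊗ y₂)`. -/
def rightAct (act : H ⊗[k] H →ₗ[k] H) (β : H →ₗ[k] Module.End k H) (S : H →ₗ[k] H) :
    H ⊗[k] H →ₗ[k] H :=
  bullet act ∘ₗ TensorProduct.map (subAntipode β S ∘ₗ act) (bullet act) ∘ₗ Coalgebra.comul

/-- `x ⊗ y ↦ (x₁ ⇀ β x₃ (y)) ⊗ x₂`. -/
def twist (act : H ⊗[k] H →ₗ[k] H) (β : H →ₗ[k] Module.End k H) :
    H ⊗[k] H →ₗ[k] H ⊗[k] H :=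
  -- (x₁ ⊗ x₂) ⊗ y ↦ (x₁ ⇀ y) ⊗ x₂
  let p : (H ⊗[k] H) ⊗[k] H →ₗ[k] H ⊗[k] H :=
    act.rTensor H ∘ₗ (TensorProduct.rightComm k H H H).toLinearMap
  -- x ⊗ y ↦ (x₁ ⊗ x₂) ⊗ β x₃ (y)
  let q : H ⊗[k] H →ₗ[k] (H ⊗[k] H) ⊗[k] H :=
    TensorProduct.map Coalgebra.comul (TensorProduct.lift β) ∘ₗ
      (TensorProduct.assoc k H H H).toLinearMap ∘ₗ
      (Coalgebra.comul (R := k) (A := H)).rTensor H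
  p ∘ₗ q

/-- `x ⊗ y ↦ (x₁ · (x₂ ⇀ β x₄ (y₁))) ⊗ (x₃ · y₂)`, that is `(m ⊗ m) (id ⊗ twist ⊗ id) (Δ ⊗ Δ)`. -/
def twistedComulMul (act : H ⊗[k] H →ₗ[k] H) (β : H →ₗ[k] Module.End k H) :
    H ⊗[k] H →ₗ[k] H ⊗[k] H :=
  -- x ⊗ y ↦ x₁ ⊗ ((x₂ ⊗ y₁) ⊗ y₂)
  let d : H ⊗[k] H →ₗ[k] H ⊗[k] ((H ⊗[k] H) ⊗[k] H) :=
    ((TensorProduct.assoc k H H H).symm.toLinearMap).lTensor H ∘ₗ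
      (TensorProduct.assoc k H H (H ⊗[k] H)).toLinearMap ∘ₗ
      TensorProduct.map Coalgebra.comul Coalgebra.comul
  -- a ⊗ ((b ⊗ c) ⊗ d) ↦ (a · b) ⊗ (c · d)
  let m : H ⊗[k] ((H ⊗[k] H) ⊗[k] H) →ₗ[k] H ⊗[k] H :=
    TensorProduct.map (LinearMap.mul' k H) (LinearMap.mul' k H) ∘ₗ
      (TensorProduct.assoc k H H (H ⊗[k] H)).symm.toLinearMap ∘ₗ
      ((TensorProduct.assoc k H H H).toLinearMap).lTensor H
  m ∘ₗ ((twist act β).rTensor H).lTensor H ∘ₗ d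

end Operations

/-- The structure of a Yetter--Drinfeld post-Hopf algebra on a vector space `H` that is an algebra
`(H, ·, 1)` and a coalgebra `(H, Δ, ε)`. The maps `antipode` and `beta` are uniquely determined, as
convolution inverses of `id` and of `x ↦ (x ⇀ -)`. -/
@[ext]
structure YDPostHopfStruct (k : Type u) (H : Type v) [Field k] [Ring H] [Algebra k H]
    [Coalgebra k H] where
  /-- the map `S` -/
  antipode : H →ₗ[k] H
  /-- the coalgebra morphism `x ⊗ y ↦ x ⇀ y` -/
  act : H ⊗[k] H →ₗc[k] H
  /-- the convolution inverse `β` of `α : x ↦ (x ⇀ -)` -/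
  beta : H →ₗ[k] Module.End k H
  mul_antipode : ∀ x : H, LinearMap.mul' k H (antipode.lTensor H (Coalgebra.comul (R := k) x)) =
    algebraMap k H (Coalgebra.counit (R := k) x)
  antipode_mul : ∀ x : H, LinearMap.mul' k H (antipode.rTensor H (Coalgebra.comul (R := k) x)) =
    algebraMap k H (Coalgebra.counit (R := k) x)
  /-- `x ⇀ (y · z) = (x₁ ⇀ y) · (x₂ ⇀ z)` -/
  act_mul : ∀ x y z : H, act (x ⊗ₜ (y * z)) =
    LinearMap.mul' k H (TensorProduct.map ((TensorProduct.curry act.toLinearMap).flip y)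
      ((TensorProduct.curry act.toLinearMap).flip z) (Coalgebra.comul (R := k) x))
  /-- `x ⇀ (y ⇀ z) = (x₁ · (x₂ ⇀ y)) ⇀ z` -/
  act_act : ∀ x y z : H, act (x ⊗ₜ act (y ⊗ₜ z)) = act (bullet act.toLinearMap (x ⊗ₜ y) ⊗ₜ z)
  /-- `α x₁ ∘ β x₂ = ε(x) id` -/
  act_beta : ∀ x : H, LinearMap.mul' k (Module.End k H)
    (TensorProduct.map (TensorProduct.curry act.toLinearMap) beta (Coalgebra.comul (R := k) x)) =
    Coalgebra.counit (R := k) x • (1 : Module.End k H)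
  /-- `β x₁ ∘ α x₂ = ε(x) id` -/
  beta_act : ∀ x : H, LinearMap.mul' k (Module.End k H)
    (TensorProduct.map beta (TensorProduct.curry act.toLinearMap) (Coalgebra.comul (R := k) x)) =
    Coalgebra.counit (R := k) x • (1 : Module.End k H)
  counit_mul : ∀ x y : H, Coalgebra.counit (R := k) (x * y) =
    Coalgebra.counit (R := k) x * Coalgebra.counit (R := k) y
  counit_one : Coalgebra.counit (R := k) (1 : H) = 1
  comul_one : Coalgebra.comul (R := k) (1 : H) = 1 ⊗ₜ[k] 1
  /-- `Δ(x · y) = (x₁ · α x₂ (β x₄ (y₁))) ⊗ (x₃ · y₂)` -/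
  comul_mul : ∀ x y : H, Coalgebra.comul (R := k) (x * y) =
    twistedComulMul act.toLinearMap beta (x ⊗ₜ y)
  /-- `Δ(S' x) = S' x₂ ⊗ S' x₁` for `S' x = β x₁ (S x₂)` -/
  comul_subAntipode : ∀ x : H, Coalgebra.comul (R := k) (subAntipode beta antipode x) =
    TensorProduct.map (subAntipode beta antipode) (subAntipode beta antipode)
      (TensorProduct.comm k H H (Coalgebra.comul x))
  /-- `(x₁ ⇀ y₁) ⊗ (x₂ ↼ y₂) = (x₂ ⇀ y₂) ⊗ (x₁ ↼ y₁)` -/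
  act_tmul_rightAct : ∀ x y : H,
    TensorProduct.map act.toLinearMap (rightAct act.toLinearMap beta antipode)
      (Coalgebra.comul (R := k) (x ⊗ₜ[k] y)) =
    TensorProduct.map act.toLinearMap (rightAct act.toLinearMap beta antipode)
      (TensorProduct.comm k (H ⊗[k] H) (H ⊗[k] H) (Coalgebra.comul (R := k) (x ⊗ₜ[k] y)))

/-- A matched pair of actions on a bialgebra `H`. That `H` is a left and a right `H`-module
coalgebra means that the two actions are coalgebra morphisms `H ⊗ H → H`. -/
@[ext]
structure MatchedPairStruct (k : Type u) (H : Type v) [Field k] [Ring H] [Bialgebra k H] where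
  /-- the left action `a ⊗ b ↦ a ⇀ b` -/
  left : H ⊗[k] H →ₗc[k] H
  /-- the right action `a ⊗ b ↦ a ↼ b` -/
  right : H ⊗[k] H →ₗc[k] H
  one_left : ∀ a : H, left (1 ⊗ₜ a) = a
  mul_left : ∀ a b c : H, left ((a * b) ⊗ₜ c) = left (a ⊗ₜ left (b ⊗ₜ c))
  right_one : ∀ a : H, right (a ⊗ₜ 1) = a
  right_mul : ∀ a b c : H, right (a ⊗ₜ (b * c)) = right (right (a ⊗ₜ b) ⊗ₜ c)
  /-- `a ⇀ 1 = ε(a) 1` -/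
  left_one : ∀ a : H, left (a ⊗ₜ 1) = algebraMap k H (Coalgebra.counit (R := k) a)
  /-- `1 ↼ a = ε(a) 1` -/
  one_right : ∀ a : H, right (1 ⊗ₜ a) = algebraMap k H (Coalgebra.counit (R := k) a)
  /-- `a ⇀ (b · c) = (a₁ ⇀ b₁) · ((a₂ ↼ b₂) ⇀ c)` -/
  left_mul : ∀ a b c : H, left (a ⊗ₜ (b * c)) =
    LinearMap.mul' k H (TensorProduct.map left.toLinearMap
      ((TensorProduct.curry left.toLinearMap).flip c ∘ₗ right.toLinearMap)
      (Coalgebra.comul (R := k) (a ⊗ₜ[k] b)))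
  /-- `(a · b) ↼ c = (a ↼ (b₁ ⇀ c₁)) · (b₂ ↼ c₂)` -/
  mul_right : ∀ a b c : H, right ((a * b) ⊗ₜ c) =
    LinearMap.mul' k H (TensorProduct.map
      (TensorProduct.curry right.toLinearMap a ∘ₗ left.toLinearMap) right.toLinearMap
      (Coalgebra.comul (R := k) (b ⊗ₜ[k] c)))
  /-- `a · b = (a₁ ⇀ b₁) · (a₂ ↼ b₂)` -/
  mul_eq : ∀ a b : H, a * b =
    LinearMap.mul' k H (TensorProduct.map left.toLinearMap right.toLinearMap
      (Coalgebra.comul (R := k) (a ⊗ₜ[k] b)))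

/-- The type of Yetter--Drinfeld post-Hopf algebras over `k`. -/
structure YDPostHopfAlg (k : Type u) [Field k] where
  carrier : Type v
  [ring : Ring carrier]
  [algebra : Algebra k carrier]
  [coalgebra : Coalgebra k carrier]
  str : YDPostHopfStruct k carrier

attribute [instance] YDPostHopfAlg.ring YDPostHopfAlg.algebra YDPostHopfAlg.coalgebra

/-- The type of matched pairs of actions on Hopf algebras over `k`. -/
structure MatchedPair (k : Type u) [Field k] where
  carrier : Type v
  [ring : Ring carrier]
  [hopfAlgebra : HopfAlgebra k carrier]
  str : MatchedPairStruct k carrier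

attribute [instance] MatchedPair.ring MatchedPair.hopfAlgebra

namespace YDPostHopfAlg

variable {k : Type u} [Field k]

/-- A morphism of Yetter--Drinfeld post-Hopf algebras: a morphism of algebras and coalgebras that
commutes with `⇀`. -/
@[ext]
structure Hom (A B : YDPostHopfAlg.{v} k) where
  hom : A.carrier →ₐc[k] B.carrier
  map_act : ∀ x y : A.carrier, hom (A.str.act (x ⊗ₜ y)) = B.str.act (hom x ⊗ₜ hom y)

instance : Category (YDPostHopfAlg.{v} k) where
  Hom A B := Hom A B
  id A := ⟨BialgHom.id k A.carrier, fun _ _ => rfl⟩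
  comp f g := ⟨g.hom.comp f.hom, fun x y => by simp [f.map_act, g.map_act]⟩

/-- The underlying coalgebra. -/
def toCoalg : YDPostHopfAlg.{v} k ⥤ CoalgCat.{v} k where
  obj A := CoalgCat.of k A.carrier
  map f := CoalgCat.ofHom (Hom.hom f).toCoalgHom

end YDPostHopfAlg

namespace MatchedPair

variable {k : Type u} [Field k]

/-- A morphism of matched pairs of actions: a morphism of bialgebras that commutes with both
actions. -/
@[ext]
structure Hom (M N : MatchedPair.{v} k) where
  hom : M.carrier →ₐc[k] N.carrier
  map_left : ∀ a b : M.carrier, hom (M.str.left (a ⊗ₜ b)) = N.str.left (hom a ⊗ₜ hom b)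
  map_right : ∀ a b : M.carrier, hom (M.str.right (a ⊗ₜ b)) = N.str.right (hom a ⊗ₜ hom b)

instance : Category (MatchedPair.{v} k) where
  Hom M N := Hom M N
  id M := ⟨BialgHom.id k M.carrier, fun _ _ => rfl, fun _ _ => rfl⟩
  comp f g := ⟨g.hom.comp f.hom, fun a b => by simp [f.map_left, g.map_left],
    fun a b => by simp [f.map_right, g.map_right]⟩

/-- The underlying coalgebra. -/
def toCoalg : MatchedPair.{v} k ⥤ CoalgCat.{v} k where
  obj M := CoalgCat.of k M.carrier
  map f := CoalgCat.ofHom (Hom.hom f).toCoalgHom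

end MatchedPair

variable {k : Type u} [Field k]

/-- `M` is the matched pair of actions `(H_⇀, ⇀, ↼)` of `A = (H, ⇀)`: the two have the same
underlying coalgebra `H`, and the remaining operations of `M` are the product `x • y = x₁ · (x₂ ⇀ y)`,
the unit `1` and the antipode `S' x = β x₁ (S x₂)`, the left action `⇀`, and the right action
`x ↼ y = S' (x₁ ⇀ y₁) • x₂ • y₂`. The map `φ` is the identity of the underlying coalgebra. -/
def IsMatchedPairOf (A : YDPostHopfAlg.{v} k) (M : MatchedPair.{v} k) : Prop :=
  ∃ h : YDPostHopfAlg.toCoalg.obj A = MatchedPair.toCoalg.obj M,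
    let φ : A.carrier →ₗc[k] M.carrier := CoalgCat.Hom.toCoalgHom (eqToHom h)
    (∀ x y, φ (bullet A.str.act.toLinearMap (x ⊗ₜ y)) = φ x * φ y) ∧
    φ 1 = 1 ∧
    (∀ x, φ (subAntipode A.str.beta A.str.antipode x) = HopfAlgebra.antipode k (φ x)) ∧
    (∀ x y, φ (A.str.act (x ⊗ₜ y)) = M.str.left (φ x ⊗ₜ φ y)) ∧
    (∀ x y, φ (rightAct A.str.act.toLinearMap A.str.beta A.str.antipode (x ⊗ₜ y)) =
      M.str.right (φ x ⊗ₜ φ y))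

/-- `A` is the Yetter--Drinfeld post-Hopf algebra of the matched pair of actions `M = (H, ⇀, ↼)` on
a Hopf algebra `(H, •, 1, Δ, ε, T)`: the two have the same underlying coalgebra `H`, and the
remaining operations of `A` are the product `a · b = a₁ • (T a₂ ⇀ b)`, the unit `1`, the map
`S a = a₁ ⇀ T a₂`, and the action `⇀`. The map `φ` is the identity of the underlying coalgebra. -/
def IsPostHopfOf (M : MatchedPair.{v} k) (A : YDPostHopfAlg.{v} k) : Prop :=
  ∃ h : MatchedPair.toCoalg.obj M = YDPostHopfAlg.toCoalg.obj A,
    let φ : M.carrier →ₗc[k] A.carrier := CoalgCat.Hom.toCoalgHom (eqToHom h)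
    (∀ a b, φ (LinearMap.mul' k M.carrier
        (((TensorProduct.curry M.str.left.toLinearMap).flip b ∘ₗ
          HopfAlgebra.antipode k (A := M.carrier)).lTensor M.carrier
            (Coalgebra.comul (R := k) a))) = φ a * φ b) ∧
    φ 1 = 1 ∧
    (∀ a, φ (M.str.left ((HopfAlgebra.antipode k (A := M.carrier)).lTensor M.carrier
        (Coalgebra.comul (R := k) a))) = A.str.antipode (φ a)) ∧
    (∀ a b, φ (M.str.left (a ⊗ₜ b)) = A.str.act (φ a ⊗ₜ φ b))

end

end YDPostHopf

/-!
All computations take place in convolution algebras `Hom(C, A)` of maps from a coalgebra `C` to an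
algebra `A`, where coassociativity is the associativity of the product, so that no Sweedler sums are
manipulated. Precomposition with a coalgebra morphism (`pull`) and postcomposition with an algebra
morphism (`push`) are multiplicative. Writing `α x = (x ⇀ -)`, `ℓ x = (x · -)` and `λ x = (x • -)`
in `Hom(H, End H)`, the two products determine each other through `λ = ℓ * α` and `ℓ = λ * β`, where
`β` is the inverse of `α`.

From a Yetter--Drinfeld post-Hopf algebra to a matched pair: the twisted formula for `Δ(x · y)`
says that `Δ ∘ ℓ x` is `((λ ⊗ 1) * (1 ⊗ ℓ) * (β ⊗ 1)) x ∘ Δ`, and multiplying by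
`Δ ∘ α = ((α ⊗ 1) * (1 ⊗ α)) ∘ Δ` gives `Δ ∘ λ = ((λ ⊗ 1) * (1 ⊗ λ)) ∘ Δ`, so `•` is a coalgebra
morphism (`comul_comp_bulletOp`). Associativity of `•` follows from
`x ⇀ (y · z) = (x₁ ⇀ y) · (x₂ ⇀ z)` (`bulletOp_bullet`). The map `S' = β(-)(S(-))` is a right
antipode by direct computation, and also a left antipode because `λ = ℓ * α` is invertible
(`IsAlgMul.antipode_mul`). With `L`, `R`, `M` denoting the maps `⇀`, `↼`, `•` in `Hom(H ⊗ H, H)`,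
the right action is the unique solution of `L * R = M`. The compatibility `(x₁ ⇀ y₁) ⊗ (x₂ ↼ y₂) =
(x₂ ⇀ y₂) ⊗ (x₁ ↼ y₁)` says that `L ⊗ 1` and `1 ⊗ R` commute (`forall_comm_iff`), which makes `R` a
coalgebra morphism (`rightHom`), and the axioms of a matched pair follow by cancelling `L`
(`matchedPairOf`).

From a matched pair to a Yetter--Drinfeld post-Hopf algebra: `β` is `α` composed with the antipode
and `ℓ = λ * β`. Cancelling `α` reduces associativity of `ℓ` to `dotOp_mul`. The formula for
`Δ(x · y)` is obtained as above, and the commutation of `L ⊗ 1` with `1 ⊗ R` results from comparing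
the expansions of `Δ ∘ M` and `Δ ∘ (L * R)` (`left_tmul_right`).

Since `S`, `β` and the antipode of a Hopf algebra are convolution inverses and `↼` is determined by
`⇀` and `•`, the objects on both sides are determined by the coalgebra, the product and `⇀`
(`YDPostHopfStruct.ext_act`, `MatchedPairStruct.ext_left`). Hence both composites are the identity
on objects. On morphisms this follows from the faithfulness of the functors to coalgebras.
-/

namespace YDPostHopf

noncomputable section

open Coalgebra WithConv

/-! ### Convolution algebras -/

section Convolution

variable {k C D A B : Type*} [CommSemiring k] [AddCommMonoid C] [Module k C] [AddCommMonoid D]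
  [Module k D] [Semiring A] [Algebra k A] [Semiring B] [Algebra k B]

lemma conv_ext_tmul {f g : WithConv (C ⊗[k] D →ₗ[k] A)} (h : ∀ x y, f (x ⊗ₜ y) = g (x ⊗ₜ y)) :
    f = g :=
  WithConv.ext (TensorProduct.ext' h)

variable [Coalgebra k C] [Coalgebra k D]

/-- Precomposition with a coalgebra morphism, as a homomorphism of convolution monoids. -/
def pull (p : C →ₗc[k] D) : WithConv (D →ₗ[k] A) →* WithConv (C →ₗ[k] A) where
  toFun f := toConv (f.ofConv ∘ₗ p.toLinearMap)
  map_one' := by ext x; simp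
  map_mul' f g := WithConv.ext (LinearMap.convMul_comp_coalgHom_distrib f g p)

/-- Postcomposition with an algebra homomorphism, as a homomorphism of convolution monoids. -/
def push (f : A →ₐ[k] B) : WithConv (C →ₗ[k] A) →* WithConv (C →ₗ[k] B) where
  toFun g := toConv (f.toLinearMap ∘ₗ g.ofConv)
  map_one' := by ext x; simp
  map_mul' g h := WithConv.ext (LinearMap.algHom_comp_convMul_distrib f g h)

@[simp] lemma pull_apply (p : C →ₗc[k] D) (f : WithConv (D →ₗ[k] A)) (x : C) :
    pull p f x = f (p x) := rfl

@[simp] lemma push_apply (f : A →ₐ[k] B) (g : WithConv (C →ₗ[k] A)) (x : C) :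
    push f g x = f (g x) := rfl

variable (k C D) in
/-- The coalgebra morphism `x ⊗ y ↦ ε(y) x`. -/
def fstC : C ⊗[k] D →ₗc[k] C :=
  (Coalgebra.TensorProduct.rid k k C : C ⊗[k] k →ₗc[k] C).comp
    (Coalgebra.TensorProduct.map (CoalgHom.id k C) (counitCoalgHom k D))

variable (k C D) in
/-- The coalgebra morphism `x ⊗ y ↦ ε(x) y`. -/
def sndC : C ⊗[k] D →ₗc[k] D :=
  (Coalgebra.TensorProduct.lid k D : k ⊗[k] D →ₗc[k] D).comp
    (Coalgebra.TensorProduct.map (counitCoalgHom k C) (CoalgHom.id k D))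

@[simp] lemma fstC_tmul (x : C) (y : D) : fstC k C D (x ⊗ₜ y) = counit (R := k) y • x := rfl

@[simp] lemma sndC_tmul (x : C) (y : D) : sndC k C D (x ⊗ₜ y) = counit (R := k) x • y := rfl

/-- The coalgebra morphism `x ↦ x ⊗ e`, for a group-like element `e`. -/
def tmulRight {e : D} (h : comul (R := k) e = e ⊗ₜ e) (h' : counit (R := k) e = 1) :
    C →ₗc[k] C ⊗[k] D where
  __ := (TensorProduct.mk k C D).flip e
  counit_comp := by
    ext x
    simp [h']
  map_comp_comul := by
    ext x
    simp only [LinearMap.comp_apply, LinearMap.flip_apply, TensorProduct.mk_apply,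
      TensorProduct.comul_tmul, h]
    induction comul (R := k) x with
    | zero => simp
    | add a b ha hb => simp only [map_add, TensorProduct.add_tmul, ha, hb]
    | tmul a b => simp

/-- The coalgebra morphism `y ↦ e ⊗ y`, for a group-like element `e`. -/
def tmulLeft {e : C} (h : comul (R := k) e = e ⊗ₜ e) (h' : counit (R := k) e = 1) :
    D →ₗc[k] C ⊗[k] D where
  __ := TensorProduct.mk k C D e
  counit_comp := by
    ext x
    simp [h']
  map_comp_comul := by
    ext x
    simp only [LinearMap.comp_apply, TensorProduct.mk_apply, TensorProduct.comul_tmul, h]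
    induction comul (R := k) x with
    | zero => simp
    | add a b ha hb => simp only [map_add, TensorProduct.tmul_add, ha, hb]
    | tmul a b => simp

/-- `(f * (g ∘ fst))(x ⊗ y) = f(x₁ ⊗ y) g(x₂)`. -/
lemma mul_pull_fst_tmul (f : WithConv (C ⊗[k] D →ₗ[k] A)) (g : WithConv (C →ₗ[k] A)) (x : C)
    (y : D) : (f * pull (fstC k C D) g) (x ⊗ₜ y) =
      LinearMap.mul' k A (TensorProduct.map ((TensorProduct.curry f.ofConv).flip y) g.ofConv
        (comul (R := k) x)) := by
  have key (t : C ⊗[k] C) (s : D ⊗[k] D) :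
      LinearMap.mul' k A (TensorProduct.map f.ofConv (pull (fstC k C D) g).ofConv
        (AlgebraTensorModule.tensorTensorTensorComm k k k k C C D D (t ⊗ₜ s))) =
      LinearMap.mul' k A (TensorProduct.map
        ((TensorProduct.curry f.ofConv).flip
          (TensorProduct.rid k D ((counit (R := k)).lTensor D s))) g.ofConv t) := by
    induction t with
    | zero => simp
    | add a b ha hb => simp only [TensorProduct.add_tmul, map_add, ha, hb]
    | tmul a b =>
      induction s with
      | zero => simp
      | add c d hc hd =>
        simp only [TensorProduct.tmul_add, map_add, hc, hd, TensorProduct.map_add_left,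
          LinearMap.add_apply]
      | tmul c d => simp
  rw [LinearMap.convMul_apply, TensorProduct.comul_tmul, key]
  simp

/-- `((f ∘ fst) * g)(x ⊗ y) = f(x₁) g(x₂ ⊗ y)`. -/
lemma pull_fst_mul_tmul (f : WithConv (C →ₗ[k] A)) (g : WithConv (C ⊗[k] D →ₗ[k] A)) (x : C)
    (y : D) : (pull (fstC k C D) f * g) (x ⊗ₜ y) =
      LinearMap.mul' k A (TensorProduct.map f.ofConv ((TensorProduct.curry g.ofConv).flip y)
        (comul (R := k) x)) := by
  have key (t : C ⊗[k] C) (s : D ⊗[k] D) :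
      LinearMap.mul' k A (TensorProduct.map (pull (fstC k C D) f).ofConv g.ofConv
        (AlgebraTensorModule.tensorTensorTensorComm k k k k C C D D (t ⊗ₜ s))) =
      LinearMap.mul' k A (TensorProduct.map f.ofConv
        ((TensorProduct.curry g.ofConv).flip
          (TensorProduct.lid k D ((counit (R := k)).rTensor D s))) t) := by
    induction t with
    | zero => simp
    | add a b ha hb => simp only [TensorProduct.add_tmul, map_add, ha, hb]
    | tmul a b =>
      induction s with
      | zero => simp
      | add c d hc hd =>
        simp only [TensorProduct.tmul_add, map_add, hc, hd, TensorProduct.map_add_right,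
          LinearMap.add_apply]
      | tmul c d => simp
  rw [LinearMap.convMul_apply, TensorProduct.comul_tmul, key]
  simp

/-- `(f * (g ∘ snd))(x ⊗ y) = f(x ⊗ y₁) g(y₂)`. -/
lemma mul_pull_snd_tmul (f : WithConv (C ⊗[k] D →ₗ[k] A)) (g : WithConv (D →ₗ[k] A)) (x : C)
    (y : D) : (f * pull (sndC k C D) g) (x ⊗ₜ y) =
      LinearMap.mul' k A (TensorProduct.map (TensorProduct.curry f.ofConv x) g.ofConv
        (comul (R := k) y)) := by
  have key (t : C ⊗[k] C) (s : D ⊗[k] D) :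
      LinearMap.mul' k A (TensorProduct.map f.ofConv (pull (sndC k C D) g).ofConv
        (AlgebraTensorModule.tensorTensorTensorComm k k k k C C D D (t ⊗ₜ s))) =
      LinearMap.mul' k A (TensorProduct.map
        (TensorProduct.curry f.ofConv
          (TensorProduct.rid k C ((counit (R := k)).lTensor C t))) g.ofConv s) := by
    induction s with
    | zero => simp
    | add a b ha hb => simp only [TensorProduct.tmul_add, map_add, ha, hb]
    | tmul a b =>
      induction t with
      | zero => simp
      | add c d hc hd =>
        simp only [TensorProduct.add_tmul, map_add, hc, hd, TensorProduct.map_add_left,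
          LinearMap.add_apply]
      | tmul c d => simp
  rw [LinearMap.convMul_apply, TensorProduct.comul_tmul, key]
  simp

lemma pull_fst_mul_pull_snd_tmul (f : WithConv (C →ₗ[k] A)) (g : WithConv (D →ₗ[k] A)) (x : C)
    (y : D) : (pull (fstC k C D) f * pull (sndC k C D) g) (x ⊗ₜ y) = f x * g y := by
  have key (t : C ⊗[k] C) :
      LinearMap.mul' k A (TensorProduct.map f.ofConv
        ((TensorProduct.curry (pull (sndC k C D) g).ofConv).flip y) t) =
      f (TensorProduct.rid k C ((counit (R := k)).lTensor C t)) * g y := by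
    induction t with
    | zero => simp
    | add a b ha hb => simp only [map_add, ha, hb, add_mul]
    | tmul a b => simp
  rw [pull_fst_mul_tmul, key]
  simp

end Convolution

section BilinearConvolution

variable {k C U V W X Y Z : Type*} [CommSemiring k] [AddCommMonoid C] [Module k C] [Coalgebra k C]
  [AddCommMonoid U] [Module k U] [AddCommMonoid V] [Module k V] [AddCommMonoid W] [Module k W]
  [AddCommMonoid X] [Module k X] [AddCommMonoid Y] [Module k Y] [AddCommMonoid Z] [Module k Z]

/-- The convolution `x ↦ μ (f x₁) (g x₂)` of two linear maps along a bilinear map `μ`. -/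
def bconv (μ : U →ₗ[k] V →ₗ[k] W) (f : C →ₗ[k] U) (g : C →ₗ[k] V) : C →ₗ[k] W :=
  TensorProduct.lift (μ.compl₁₂ f g) ∘ₗ comul

lemma bconv_assoc {μ : U →ₗ[k] V →ₗ[k] X} {μ' : X →ₗ[k] W →ₗ[k] Z} {ν : V →ₗ[k] W →ₗ[k] Y}
    {ν' : U →ₗ[k] Y →ₗ[k] Z} (h : ∀ u v w, μ' (μ u v) w = ν' u (ν v w))
    (f : C →ₗ[k] U) (g : C →ₗ[k] V) (j : C →ₗ[k] W) :
    bconv μ' (bconv μ f g) j = bconv ν' f (bconv ν g j) := by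
  ext x
  have h₁ (t : C ⊗[k] C) : TensorProduct.lift (μ'.compl₁₂ (bconv μ f g) j) t =
      TensorProduct.lift (ν'.compl₁₂ f (TensorProduct.lift (ν.compl₁₂ g j)))
        (TensorProduct.assoc k C C C (comul.rTensor C t)) := by
    induction t with
    | zero => simp
    | add a b ha hb => simp only [map_add, ha, hb]
    | tmul a b =>
      simp only [bconv, TensorProduct.lift.tmul, LinearMap.compl₁₂_apply, LinearMap.comp_apply,
        LinearMap.rTensor_tmul]
      induction comul (R := k) a with
      | zero => simp
      | add c d hc hd => simp only [map_add, hc, hd, LinearMap.add_apply, TensorProduct.add_tmul]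
      | tmul c d => simp [h]
  have h₂ (t : C ⊗[k] C) : TensorProduct.lift (ν'.compl₁₂ f (bconv ν g j)) t =
      TensorProduct.lift (ν'.compl₁₂ f (TensorProduct.lift (ν.compl₁₂ g j)))
        (comul.lTensor C t) := by
    induction t with
    | zero => simp
    | add a b ha hb => simp only [map_add, ha, hb]
    | tmul a b => simp [bconv]
  change TensorProduct.lift (μ'.compl₁₂ (bconv μ f g) j) (comul x) =
    TensorProduct.lift (ν'.compl₁₂ f (bconv ν g j)) (comul x)
  rw [h₁, h₂, coassoc_apply]

lemma bconv_counit_left {μ : U →ₗ[k] V →ₗ[k] V} {e : U} (h : ∀ v, μ e v = v) (f : C →ₗ[k] V) :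
    bconv μ (counit.smulRight e) f = f := by
  ext x
  have h₁ (t : C ⊗[k] C) : TensorProduct.lift (μ.compl₁₂ (counit.smulRight e) f) t =
      f (TensorProduct.lid k C ((counit (R := k)).rTensor C t)) := by
    induction t with
    | zero => simp
    | add a b ha hb => simp only [map_add, ha, hb]
    | tmul a b => simp [h]
  change TensorProduct.lift (μ.compl₁₂ (counit.smulRight e) f) (comul x) = f x
  rw [h₁]
  simp

lemma bconv_counit_right {μ : V →ₗ[k] U →ₗ[k] V} {e : U} (h : ∀ v, μ v e = v) (f : C →ₗ[k] V) :
    bconv μ f (counit.smulRight e) = f := by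
  ext x
  have h₁ (t : C ⊗[k] C) : TensorProduct.lift (μ.compl₁₂ f (counit.smulRight e)) t =
      f (TensorProduct.rid k C ((counit (R := k)).lTensor C t)) := by
    induction t with
    | zero => simp
    | add a b ha hb => simp only [map_add, ha, hb]
    | tmul a b => simp [h]
  change TensorProduct.lift (μ.compl₁₂ f (counit.smulRight e)) (comul x) = f x
  rw [h₁]
  simp

lemma bconv_mul {A : Type*} [Semiring A] [Algebra k A] (f g : WithConv (C →ₗ[k] A)) :
    bconv (LinearMap.mul k A) f.ofConv g.ofConv = (f * g).ofConv := by
  have h : TensorProduct.lift ((LinearMap.mul k A).compl₁₂ f.ofConv g.ofConv) =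
      LinearMap.mul' k A ∘ₗ TensorProduct.map f.ofConv g.ofConv := by
    ext a b
    simp
  rw [bconv, h]
  rfl

lemma ofConv_one {A : Type*} [Semiring A] [Algebra k A] :
    (1 : WithConv (C →ₗ[k] A)).ofConv = counit.smulRight (1 : A) := by
  ext x
  simp [LinearMap.convOne_apply, Algebra.algebraMap_eq_smul_one]

end BilinearConvolution

/-! ### Families of endomorphisms of a coalgebra -/

section Endomorphisms

variable {k C V W : Type*} [CommSemiring k] [AddCommMonoid C] [Module k C] [Coalgebra k C]
  [AddCommMonoid V] [Module k V] [AddCommMonoid W] [Module k W]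

/-- `x ↦ F x ⊗ id`. -/
def onLeft (F : WithConv (C →ₗ[k] Module.End k V)) :
    WithConv (C →ₗ[k] Module.End k (V ⊗[k] V)) :=
  push (Module.End.rTensorAlgHom k V V) F

/-- `x ↦ id ⊗ F x`. -/
def onRight (F : WithConv (C →ₗ[k] Module.End k V)) :
    WithConv (C →ₗ[k] Module.End k (V ⊗[k] V)) :=
  push (Module.End.lTensorAlgHom k V V) F

@[simp] lemma onLeft_apply_tmul (F : WithConv (C →ₗ[k] Module.End k V)) (x : C) (v w : V) :
    onLeft F x (v ⊗ₜ w) = F x v ⊗ₜ w := rfl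

@[simp] lemma onRight_apply_tmul (F : WithConv (C →ₗ[k] Module.End k V)) (x : C) (v w : V) :
    onRight F x (v ⊗ₜ w) = v ⊗ₜ F x w := rfl

lemma onLeft_mul (F G : WithConv (C →ₗ[k] Module.End k V)) :
    onLeft (F * G) = onLeft F * onLeft G := map_mul _ _ _

lemma onRight_mul (F G : WithConv (C →ₗ[k] Module.End k V)) :
    onRight (F * G) = onRight F * onRight G := map_mul _ _ _

lemma onLeft_one : onLeft (1 : WithConv (C →ₗ[k] Module.End k V)) = 1 := map_one _

lemma onRight_one : onRight (1 : WithConv (C →ₗ[k] Module.End k V)) = 1 := map_one _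

/-- Intertwining of families of endomorphisms is stable under convolution. -/
lemma comp_convMul_eq {δ : V →ₗ[k] W} {F F' : WithConv (C →ₗ[k] Module.End k V)}
    {G G' : WithConv (C →ₗ[k] Module.End k W)} (h : ∀ x, δ ∘ₗ F x = G x ∘ₗ δ)
    (h' : ∀ x, δ ∘ₗ F' x = G' x ∘ₗ δ) (x : C) : δ ∘ₗ (F * F') x = (G * G') x ∘ₗ δ := by
  rw [LinearMap.convMul_apply, LinearMap.convMul_apply]
  induction comul (R := k) x with
  | zero => simp
  | add a b ha hb => simp only [map_add, LinearMap.comp_add, LinearMap.add_comp, ha, hb]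
  | tmul a b =>
    simp only [TensorProduct.map_tmul, LinearMap.mul'_apply, Module.End.mul_eq_comp]
    rw [← LinearMap.comp_assoc, h, LinearMap.comp_assoc, h', LinearMap.comp_assoc]

/-- `((F ⊗ 1) * (1 ⊗ G)) x (v ⊗ w) = F x₁ v ⊗ G x₂ w`. -/
lemma onLeft_mul_onRight_tmul (F G : WithConv (C →ₗ[k] Module.End k V)) (x : C) (v w : V) :
    (onLeft F * onRight G) x (v ⊗ₜ w) =
      TensorProduct.map (F.ofConv.flip v) (G.ofConv.flip w) (comul x) := by
  rw [LinearMap.convMul_apply]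
  induction comul (R := k) x with
  | zero => simp
  | add a b ha hb => simp only [map_add, LinearMap.add_apply, ha, hb]
  | tmul a b =>
    change onLeft F a (onRight G b (v ⊗ₜ w)) = _
    simp

variable [Coalgebra k V]

lemma map_map_comul_tmul (f : C ⊗[k] V →ₗ[k] V) (x : C) (y : V) :
    TensorProduct.map f f (comul (R := k) (x ⊗ₜ[k] y)) =
      (onLeft (toConv (TensorProduct.curry f)) * onRight (toConv (TensorProduct.curry f))) x
        (comul y) := by
  rw [TensorProduct.comul_tmul]
  induction comul (R := k) y with
  | zero => simp
  | add a b ha hb => simp only [TensorProduct.tmul_add, map_add, ha, hb]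
  | tmul a b =>
    rw [onLeft_mul_onRight_tmul]
    induction comul (R := k) x with
    | zero => simp
    | add c d hc hd => simp only [TensorProduct.add_tmul, map_add, hc, hd]
    | tmul c d => simp

/-- A coalgebra morphism `f` on `C ⊗ V` satisfies `Δ ∘ f(x ⊗ -) = (f(x₁ ⊗ -) ⊗ f(x₂ ⊗ -)) ∘ Δ`. -/
lemma comul_comp_curry (f : C ⊗[k] V →ₗc[k] V) (x : C) :
    comul ∘ₗ TensorProduct.curry f.toLinearMap x =
      (onLeft (toConv (TensorProduct.curry f.toLinearMap)) *
        onRight (toConv (TensorProduct.curry f.toLinearMap))) x ∘ₗ comul := by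
  ext y
  change comul (f (x ⊗ₜ y)) = _
  rw [← CoalgHomClass.map_comp_comul_apply, LinearMap.comp_apply, ← map_map_comul_tmul]
  rfl

end Endomorphisms

section Operations

variable {k : Type u} {H : Type v} [Field k] [Ring H] [Algebra k H] [Coalgebra k H]

lemma bullet_tmul (act : H ⊗[k] H →ₗ[k] H) (x y : H) :
    bullet act (x ⊗ₜ y) =
      (toConv (LinearMap.mul k H) * toConv (TensorProduct.curry act)) x y := by
  rw [LinearMap.convMul_apply]
  simp only [bullet, LinearMap.comp_apply, LinearMap.rTensor_tmul]
  induction comul (R := k) x with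
  | zero => simp
  | add a b ha hb =>
    simp only [map_add, TensorProduct.add_tmul, LinearMap.add_apply, ha, hb]
  | tmul a b => simp

lemma subAntipode_eq_bconv (β : H →ₗ[k] Module.End k H) (S : H →ₗ[k] H) :
    subAntipode β S = bconv LinearMap.id β S := rfl

lemma twistedComulMul_tmul (act : H ⊗[k] H →ₗ[k] H) (β : H →ₗ[k] Module.End k H) (x y : H) :
    twistedComulMul act β (x ⊗ₜ y) =
      (onLeft (toConv (LinearMap.mul k H)) * ((onLeft (toConv (TensorProduct.curry act)) *
        onRight (toConv (LinearMap.mul k H))) * onLeft (toConv β))) x (comul y) := by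
  simp only [twistedComulMul, LinearMap.comp_apply, TensorProduct.map_tmul]
  induction comul (R := k) y with
  | zero => simp
  | add a b ha hb => simp only [TensorProduct.tmul_add, map_add, ha, hb]
  | tmul y₁ y₂ =>
    rw [LinearMap.convMul_apply]
    induction comul (R := k) x with
    | zero => simp
    | add a b ha hb =>
      simp only [map_add, TensorProduct.add_tmul, LinearMap.add_apply, ha, hb]
    | tmul a b =>
      simp only [TensorProduct.map_tmul, LinearMap.mul'_apply, Module.End.mul_apply,
        LinearMap.convMul_apply (_ * _), twist, LinearMap.comp_apply, LinearEquiv.coe_coe,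
        TensorProduct.assoc_tmul, LinearMap.lTensor_tmul, TensorProduct.assoc_symm_tmul,
        LinearMap.rTensor_tmul]
      induction comul (R := k) b with
      | zero => simp
      | add c d hc hd =>
        simp only [map_add, TensorProduct.add_tmul, TensorProduct.tmul_add, LinearMap.add_apply,
          hc, hd]
      | tmul c d =>
        simp only [TensorProduct.map_tmul, LinearMap.mul'_apply, Module.End.mul_apply,
          TensorProduct.assoc_tmul, TensorProduct.lift.tmul, onLeft_apply_tmul]
        rw [onLeft_mul_onRight_tmul]
        induction comul (R := k) c with
        | zero => simp
        | add e f he hf =>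
          simp only [map_add, TensorProduct.add_tmul, TensorProduct.tmul_add,
            he, hf]
        | tmul e f => simp

end Operations

/-! ### The product `x • y = x₁ · (x₂ ⇀ y)` of a Yetter--Drinfeld post-Hopf algebra -/

section ActOp

variable {k : Type u} {H : Type v} [Field k] [AddCommGroup H] [Module k H] [Coalgebra k H]

/-- The map `α : x ↦ (x ⇀ -)` of a linear map `x ⊗ y ↦ x ⇀ y`, as an element of the convolution
algebra. -/
def actOp (act : H ⊗[k] H →ₗc[k] H) : WithConv (H →ₗ[k] Module.End k H) :=
  toConv (TensorProduct.curry act.toLinearMap)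

@[simp] lemma actOp_apply (act : H ⊗[k] H →ₗc[k] H) (x y : H) :
    actOp act x y = act (x ⊗ₜ y) := rfl

lemma comul_comp_actOp (act : H ⊗[k] H →ₗc[k] H) (x : H) :
    comul ∘ₗ actOp act x = (onLeft (actOp act) * onRight (actOp act)) x ∘ₗ comul :=
  comul_comp_curry act x

/-- Both sides state that `ε(f(x, y)) = ε(x) ε(y)`. -/
lemma forall_counit_iff {F : WithConv (H →ₗ[k] Module.End k H)} :
    (∀ x, counit (R := k) ∘ₗ F x =
      (1 : WithConv (H →ₗ[k] Module.End k k)) x ∘ₗ counit (R := k)) ↔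
    ∀ x y, counit (R := k) (F x y) = counit (R := k) x * counit (R := k) y := by
  refine forall_congr' fun x ↦ ?_
  rw [LinearMap.ext_iff]
  refine forall_congr' fun y ↦ ?_
  simp [LinearMap.convOne_apply, Algebra.algebraMap_eq_smul_one]

lemma counit_convMul {F F' : WithConv (H →ₗ[k] Module.End k H)}
    (h : ∀ x y, counit (R := k) (F x y) = counit (R := k) x * counit (R := k) y)
    (h' : ∀ x y, counit (R := k) (F' x y) = counit (R := k) x * counit (R := k) y) (x y : H) :
    counit (R := k) ((F * F') x y) = counit (R := k) x * counit (R := k) y := by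
  refine forall_counit_iff.1 (fun x ↦ ?_) x y
  have e := comp_convMul_eq (forall_counit_iff.2 h) (forall_counit_iff.2 h') x
  rwa [mul_one] at e

lemma counit_actOp (act : H ⊗[k] H →ₗc[k] H) (x y : H) :
    counit (R := k) (actOp act x y) = counit (R := k) x * counit (R := k) y := by
  rw [actOp_apply, CoalgHomClass.counit_comp_apply, TensorProduct.counit_tmul, smul_eq_mul,
    mul_comm]

end ActOp

section MulOp

variable {k : Type u} {H : Type v} [Field k] [Ring H] [Algebra k H]

variable (k H) in
/-- The map `x ↦ (x · -)`, as an element of the convolution algebra. -/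
def mulOp : WithConv (H →ₗ[k] Module.End k H) := toConv (LinearMap.mul k H)

@[simp] lemma mulOp_apply (x y : H) : mulOp k H x y = x * y := rfl

variable [Coalgebra k H]

lemma mulOp_eq_push : mulOp k H = push (Algebra.lmul k H) (toConv LinearMap.id) := rfl

/-- Both sides state that `x ⇀ (y · z) = (x₁ ⇀ y) · (x₂ ⇀ z)`. -/
lemma forall_act_mul_iff (act : H ⊗[k] H →ₗc[k] H) :
    (∀ x y z : H, act (x ⊗ₜ (y * z)) =
      LinearMap.mul' k H (TensorProduct.map ((TensorProduct.curry act.toLinearMap).flip y)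
        ((TensorProduct.curry act.toLinearMap).flip z) (comul (R := k) x))) ↔
    pull (fstC k H H) (actOp act) * pull (sndC k H H) (mulOp k H) =
      pull act (mulOp k H) * pull (fstC k H H) (actOp act) := by
  have h (x y z : H) : (pull act (mulOp k H) * pull (fstC k H H) (actOp act)) (x ⊗ₜ y) z =
      LinearMap.mul' k H (TensorProduct.map ((TensorProduct.curry act.toLinearMap).flip y)
        ((TensorProduct.curry act.toLinearMap).flip z) (comul (R := k) x)) := by
    rw [mul_pull_fst_tmul]
    induction comul (R := k) x with
    | zero => simp
    | add a b ha hb => simp only [map_add, LinearMap.add_apply, ha, hb]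
    | tmul a b => simp
  constructor
  · intro H'
    refine conv_ext_tmul fun x y ↦ LinearMap.ext fun z ↦ ?_
    rw [h, pull_fst_mul_pull_snd_tmul, ← H']
    rfl
  · intro e x y z
    rw [← h, ← e, pull_fst_mul_pull_snd_tmul]
    rfl

lemma convMul_antipode_iff (S : H →ₗ[k] H) :
    (∀ x : H, LinearMap.mul' k H (S.lTensor H (comul (R := k) x)) =
      algebraMap k H (counit (R := k) x)) ↔ toConv LinearMap.id * toConv S = 1 :=
  ⟨fun h ↦ by ext x; exact h x, fun h x ↦ congr($h x)⟩

lemma antipode_convMul_iff (S : H →ₗ[k] H) :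
    (∀ x : H, LinearMap.mul' k H (S.rTensor H (comul (R := k) x)) =
      algebraMap k H (counit (R := k) x)) ↔ toConv S * toConv LinearMap.id = 1 :=
  ⟨fun h ↦ by ext x; exact h x, fun h x ↦ congr($h x)⟩

end MulOp

namespace YDPostHopfStruct

variable {k : Type u} {H : Type v} [Field k] [Ring H] [Algebra k H] [Coalgebra k H]
  (X : YDPostHopfStruct k H)

lemma actOp_mul_beta : actOp X.act * toConv X.beta = 1 := by
  refine WithConv.ext (LinearMap.ext fun x ↦ ?_)
  exact (X.act_beta x).trans (Algebra.algebraMap_eq_smul_one _).symm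

lemma beta_mul_actOp : toConv X.beta * actOp X.act = 1 := by
  refine WithConv.ext (LinearMap.ext fun x ↦ ?_)
  exact (X.beta_act x).trans (Algebra.algebraMap_eq_smul_one _).symm

lemma antipode_mul_mulOp : push (Algebra.lmul k H) (toConv X.antipode) * mulOp k H = 1 := by
  rw [mulOp_eq_push, ← map_mul, (antipode_convMul_iff _).1 X.antipode_mul, map_one]

/-- `x ↦ (x • -)`. -/
def bulletOp : WithConv (H →ₗ[k] Module.End k H) := mulOp k H * actOp X.act

lemma bulletOp_apply (x y : H) : X.bulletOp x y = bullet X.act.toLinearMap (x ⊗ₜ y) :=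
  (bullet_tmul _ x y).symm

lemma bulletOp_mul_beta : X.bulletOp * toConv X.beta = mulOp k H := by
  rw [bulletOp, mul_assoc, actOp_mul_beta, mul_one]

lemma act_mul_conv : pull (fstC k H H) (actOp X.act) * pull (sndC k H H) (mulOp k H) =
    pull X.act (mulOp k H) * pull (fstC k H H) (actOp X.act) :=
  (forall_act_mul_iff _).1 X.act_mul

lemma one_act (y : H) : X.act (1 ⊗ₜ y) = y := by
  have hinv : actOp X.act 1 * X.beta 1 = 1 := by
    have h := congr($(X.actOp_mul_beta) 1)
    simpa [LinearMap.convMul_apply, X.comul_one, X.counit_one] using h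
  have hinv' : X.beta 1 * actOp X.act 1 = 1 := by
    have h := congr($(X.beta_mul_actOp) 1)
    simpa [LinearMap.convMul_apply, X.comul_one, X.counit_one] using h
  have hmul (y z : H) : X.act (1 ⊗ₜ (y * z)) = X.act (1 ⊗ₜ y) * X.act (1 ⊗ₜ z) := by
    simpa [X.comul_one] using X.act_mul 1 y z
  -- `α 1` is bijective and multiplicative, hence preserves the unit
  have hone : X.act (1 ⊗ₜ 1) = 1 := by
    have h := hmul 1 (X.beta 1 1)
    have h1 : X.act (1 ⊗ₜ X.beta 1 1) = 1 := congr($hinv 1)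
    rw [one_mul, h1, mul_one] at h
    exact h.symm
  have hidem : actOp X.act 1 * actOp X.act 1 = actOp X.act 1 := by
    ext z
    have h := X.act_act 1 1 z
    rw [bullet_tmul] at h
    rw [LinearMap.convMul_apply, X.comul_one] at h
    simpa [hone] using h
  have h : actOp X.act 1 = 1 := by
    calc actOp X.act 1 = (X.beta 1 * actOp X.act 1) * actOp X.act 1 := by rw [hinv', one_mul]
      _ = 1 := by rw [mul_assoc, hidem, hinv']
  exact congr($h y)

lemma act_one (x : H) : X.act (x ⊗ₜ 1) = counit (R := k) x • (1 : H) := by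
  -- `α = ℓ(α(-)1) * α` in the convolution algebra, and `α` is invertible there
  let j : H →ₗc[k] H ⊗[k] H := tmulRight X.comul_one X.counit_one
  have h := congr(pull j $(X.act_mul_conv))
  have h₁ : pull j (pull (fstC k H H) (actOp X.act)) = actOp X.act := by
    ext x y
    change actOp X.act (counit (R := k) (1 : H) • x) y = _
    rw [X.counit_one, one_smul]
  have h₂ : pull j (pull (sndC k H H) (mulOp k H)) = 1 := by
    ext x y
    change mulOp k H (counit (R := k) x • (1 : H)) y = _
    simp [Algebra.algebraMap_eq_smul_one]
  rw [map_mul, map_mul, h₁, h₂, mul_one] at h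
  have h₃ : pull j (pull X.act (mulOp k H)) = 1 := by
    have h' := congr($h * toConv X.beta)
    rwa [mul_assoc, actOp_mul_beta, mul_one, eq_comm] at h'
  have h₄ := congr($h₃ x 1)
  change X.act (x ⊗ₜ 1) * 1 = _ at h₄
  rw [mul_one] at h₄
  rw [h₄]
  simp [Algebra.algebraMap_eq_smul_one]

/-- The formula `Δ(x · y) = (x₁ · (x₂ ⇀ β x₄ (y₁))) ⊗ (x₃ · y₂)` in the convolution algebra. -/
lemma comul_comp_mulOp (x : H) : comul ∘ₗ mulOp k H x =
    (onLeft X.bulletOp * onRight (mulOp k H) * onLeft (toConv X.beta)) x ∘ₗ comul := by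
  ext y
  refine (X.comul_mul x y).trans ?_
  rw [twistedComulMul_tmul, bulletOp, onLeft_mul]
  simp only [mul_assoc]
  rfl

/-- The factor `β ⊗ 1` in `comul_comp_mulOp` cancels against the factor `α ⊗ 1` in
`comul_comp_actOp`. -/
lemma comul_comp_bulletOp (x : H) : comul ∘ₗ X.bulletOp x =
    (onLeft X.bulletOp * onRight X.bulletOp) x ∘ₗ comul := by
  have h := comp_convMul_eq X.comul_comp_mulOp (comul_comp_actOp X.act) x
  have e : onLeft X.bulletOp * onRight (mulOp k H) * onLeft (toConv X.beta) *
      (onLeft (actOp X.act) * onRight (actOp X.act)) =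
      onLeft X.bulletOp * onRight X.bulletOp := by
    rw [mul_assoc, ← mul_assoc (onLeft (toConv X.beta)), ← onLeft_mul, beta_mul_actOp, onLeft_one,
      one_mul, mul_assoc, ← onRight_mul, bulletOp]
  rwa [e] at h

lemma counit_bullet (x y : H) : counit (R := k) (bullet X.act.toLinearMap (x ⊗ₜ y)) =
    counit (R := k) x * counit (R := k) y := by
  rw [← bulletOp_apply]
  exact counit_convMul X.counit_mul (counit_actOp X.act) x y

/-- `•` as a coalgebra morphism. -/
def bulletHom : H ⊗[k] H →ₗc[k] H where
  __ := bullet X.act.toLinearMap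
  counit_comp := by
    ext x y
    simpa [mul_comm] using X.counit_bullet x y
  map_comp_comul := by
    have hb : X.bulletOp = toConv (TensorProduct.curry (bullet X.act.toLinearMap)) := by
      ext x y
      exact X.bulletOp_apply x y
    ext x y
    refine (map_map_comul_tmul (bullet X.act.toLinearMap) x y).trans ?_
    rw [← hb]
    refine congr($(X.comul_comp_bulletOp x) y).symm.trans ?_
    exact congrArg _ (X.bulletOp_apply x y)

lemma bulletHom_tmul (x y : H) : X.bulletHom (x ⊗ₜ y) = X.bulletOp x y :=
  (X.bulletOp_apply x y).symm

lemma actOp_bullet : pull X.bulletHom (actOp X.act) =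
    pull (fstC k H H) (actOp X.act) * pull (sndC k H H) (actOp X.act) := by
  refine conv_ext_tmul fun x y ↦ LinearMap.ext fun z ↦ ?_
  rw [pull_fst_mul_pull_snd_tmul]
  exact (X.act_act x y z).symm

lemma bulletOp_bullet : pull X.bulletHom X.bulletOp =
    pull (fstC k H H) X.bulletOp * pull (sndC k H H) X.bulletOp := by
  have h : pull X.bulletHom (mulOp k H) =
      pull (fstC k H H) (mulOp k H) * pull X.act (mulOp k H) := by
    refine conv_ext_tmul fun x y ↦ LinearMap.ext fun z ↦ ?_
    change bullet X.act.toLinearMap (x ⊗ₜ y) * z = _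
    rw [pull_fst_mul_tmul, bullet_tmul, LinearMap.convMul_apply]
    induction comul (R := k) x with
    | zero => simp
    | add a b ha hb => simp only [map_add, LinearMap.add_apply, add_mul, ha, hb]
    | tmul a b => exact mul_assoc _ _ _
  rw [bulletOp, map_mul, h, actOp_bullet, mul_assoc, ← mul_assoc (pull X.act _), ← act_mul_conv,
    map_mul, map_mul]
  simp only [mul_assoc]

lemma bulletOp_assoc (x y : H) : X.bulletOp (X.bulletOp x y) = X.bulletOp x * X.bulletOp y := by
  have h := congr($(X.bulletOp_bullet) (x ⊗ₜ y))
  rwa [pull_fst_mul_pull_snd_tmul, pull_apply, bulletHom_tmul] at h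

lemma bulletOp_one_left (y : H) : X.bulletOp 1 y = y := by
  rw [bulletOp, LinearMap.convMul_apply, X.comul_one]
  simpa [mulOp] using X.one_act y

lemma bulletOp_one_right (x : H) : X.bulletOp x 1 = x := by
  have h : (X.bulletOp).ofConv.flip 1 = LinearMap.id := by
    have h₁ : (X.bulletOp).ofConv.flip 1 =
        bconv (LinearMap.mul k H) LinearMap.id (counit.smulRight (1 : H)) := by
      ext x
      change X.bulletOp x 1 = _
      rw [bulletOp, LinearMap.convMul_apply]
      simp only [bconv, LinearMap.comp_apply]
      induction comul (R := k) x with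
      | zero => simp
      | add a b ha hb => simp only [map_add, LinearMap.add_apply, ha, hb]
      | tmul a b =>
        change a * X.act (b ⊗ₜ 1) = _
        simp [act_one]
    rw [h₁]
    exact bconv_counit_right (fun v ↦ mul_one v) _
  exact congr($h x)

lemma bulletOp_subAntipode :
    bconv LinearMap.id X.bulletOp.ofConv (subAntipode X.beta X.antipode) =
      counit.smulRight (1 : H) := by
  rw [subAntipode_eq_bconv,
    ← bconv_assoc (μ := LinearMap.mul k (Module.End k H)) (μ' := LinearMap.id) (fun u v w ↦ rfl),
    show X.beta = (toConv X.beta).ofConv from rfl, bconv_mul, bulletOp_mul_beta]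
  ext x
  have h := X.mul_antipode x
  rw [Algebra.algebraMap_eq_smul_one] at h
  refine Eq.trans ?_ h
  simp only [bconv, LinearMap.comp_apply]
  induction comul (R := k) x with
  | zero => simp
  | add a b ha hb => simp only [map_add, ha, hb]
  | tmul a b => simp

end YDPostHopfStruct

/-! ### Hopf algebras with a given underlying coalgebra -/

section Builders

variable {k : Type u} {H : Type v} [Field k] [AddCommGroup H] [Module k H]

/-- The map `x ⊗ y ↦ m x y` is an associative multiplication with unit `e`. -/
structure IsAlgMul (m : H →ₗ[k] Module.End k H) (e : H) : Prop where
  one_mul : ∀ y, m e y = y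
  mul_one : ∀ x, m x e = x
  mul_assoc : ∀ x y, m (m x y) = m x * m y

namespace IsAlgMul

variable {m : H →ₗ[k] Module.End k H} {e : H} (h : IsAlgMul m e)

/-- The ring with underlying additive group `H`, multiplication `m` and unit `e`. -/
abbrev ring : Ring H where
  mul x y := m x y
  one := e
  left_distrib x y z := map_add (m x) y z
  right_distrib x y z := by
    change m (x + y) z = m x z + m y z
    rw [map_add, LinearMap.add_apply]
  zero_mul x := by
    change m 0 x = 0
    rw [map_zero, LinearMap.zero_apply]
  mul_zero x := map_zero (m x)
  mul_assoc x y z := congr($(h.mul_assoc x y) z)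
  one_mul := h.one_mul
  mul_one := h.mul_one
  zsmul := fun n x ↦ n • x
  zsmul_zero' := zero_zsmul
  zsmul_succ' n x := SubNegMonoid.zsmul_succ' n x
  zsmul_neg' n x := SubNegMonoid.zsmul_neg' n x
  nsmul := fun n x ↦ n • x
  nsmul_zero := zero_nsmul
  nsmul_succ n x := succ_nsmul x n
  neg_add_cancel := neg_add_cancel
  sub_eq_add_neg := sub_eq_add_neg

/-- The algebra with underlying vector space `H`, multiplication `m` and unit `e`. -/
abbrev algebra : @Algebra k H _ h.ring.toSemiring :=
  letI := h.ring
  Algebra.ofModule (fun r x y ↦ by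
      change m (r • x) y = r • m x y
      rw [map_smul, LinearMap.smul_apply])
    (fun r x y ↦ map_smul (m x) r y)

end IsAlgMul

variable [Coalgebra k H]

/-- The map `x ⊗ y ↦ m x y` is the multiplication of a Hopf algebra with underlying
coalgebra `H`, unit `e` and antipode `S`. -/
structure IsHopfMul (m : H →ₗ[k] Module.End k H) (e : H) (S : H →ₗ[k] H) : Prop
    extends IsAlgMul m e where
  comul_mul : ∀ x, comul ∘ₗ m x = (onLeft (toConv m) * onRight (toConv m)) x ∘ₗ comul
  counit_mul : ∀ x y, counit (R := k) (m x y) = counit (R := k) x * counit (R := k) y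
  comul_one : comul (R := k) e = e ⊗ₜ e
  counit_one : counit (R := k) e = 1
  mul_antipode : bconv LinearMap.id m S = counit.smulRight e
  antipode_mul : ∀ x, TensorProduct.lift (m ∘ₗ S) (comul x) = counit (R := k) x • e

namespace IsHopfMul

variable {m : H →ₗ[k] Module.End k H} {e : H} {S : H →ₗ[k] H} (h : IsHopfMul m e S)

/-- The bialgebra with underlying coalgebra `H`, multiplication `m` and unit `e`. -/
abbrev bialgebra : @Bialgebra k H _ h.ring.toSemiring :=
  letI := h.ring
  letI := h.algebra
  letI : Coalgebra k H := ‹Coalgebra k H›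
  Bialgebra.mk' k H h.counit_one (h.counit_mul _ _) h.comul_one (by
    intro x y
    refine congr($(h.comul_mul x) y).trans ?_
    rw [LinearMap.comp_apply]
    induction comul (R := k) y with
    | zero => simp
    | add a b ha hb => simp only [map_add, mul_add, ha, hb]
    | tmul a b =>
      rw [onLeft_mul_onRight_tmul]
      induction comul (R := k) x with
      | zero => simp
      | add c d hc hd => simp only [map_add, add_mul, hc, hd]
      | tmul c d => exact (Algebra.TensorProduct.tmul_mul_tmul c a d b).symm)

/-- The Hopf algebra with underlying coalgebra `H`, multiplication `m`, unit `e` and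
antipode `S`. -/
abbrev hopfAlgebra : @HopfAlgebra k H _ h.ring.toSemiring :=
  letI := h.ring
  letI := h.bialgebra
  { antipode := S
    mul_antipode_rTensor_comul := by
      ext x
      refine Eq.trans ?_ ((h.antipode_mul x).trans (Algebra.algebraMap_eq_smul_one _).symm)
      simp only [LinearMap.comp_apply]
      induction comul (R := k) x with
      | zero => simp
      | add c d hc hd => simp only [map_add, hc, hd]
      | tmul c d => rfl
    mul_antipode_lTensor_comul := by
      ext x
      refine Eq.trans ?_ (congr($(h.mul_antipode) x).trans
        (Algebra.algebraMap_eq_smul_one _).symm)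
      simp only [LinearMap.comp_apply, bconv]
      induction comul (R := k) x with
      | zero => simp
      | add c d hc hd => simp only [map_add, hc, hd]
      | tmul c d => rfl }

end IsHopfMul

/-- A right antipode for the multiplication `m` is a left antipode as soon as `x ↦ (x • -)` has a
left inverse in the convolution algebra. -/
lemma IsAlgMul.antipode_mul {m : H →ₗ[k] Module.End k H} {e : H} {S : H →ₗ[k] H}
    (h : IsAlgMul m e) (hS : bconv LinearMap.id m S = counit.smulRight e)
    {G : WithConv (H →ₗ[k] Module.End k H)} (hG : G * toConv m = 1) (x : H) :
    TensorProduct.lift (m ∘ₗ S) (comul x) = counit (R := k) x • e := by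
  have h₁ : toConv m * toConv (m ∘ₗ S) = 1 := by
    refine WithConv.ext (LinearMap.ext fun x ↦ ?_)
    have hx : m (bconv LinearMap.id m S x) = counit (R := k) x • (1 : Module.End k H) := by
      rw [hS]
      ext y
      simp [h.one_mul]
    refine Eq.trans ?_ (hx.trans (Algebra.algebraMap_eq_smul_one _).symm)
    rw [LinearMap.convMul_apply]
    simp only [LinearMap.comp_apply, bconv]
    induction comul (R := k) x with
    | zero => simp
    | add c d hc hd => simp only [map_add, hc, hd]
    | tmul c d => exact (h.mul_assoc _ _).symm
  have h₂ : toConv (m ∘ₗ S) * toConv m = 1 := by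
    rw [← left_inv_eq_right_inv hG h₁, hG]
  have h₃ := congr($h₂ x e)
  rw [LinearMap.convMul_apply, LinearMap.convOne_apply, Algebra.algebraMap_eq_smul_one] at h₃
  refine Eq.trans ?_ h₃
  induction comul (R := k) x with
  | zero => simp
  | add c d hc hd => simp only [map_add, LinearMap.add_apply, hc, hd]
  | tmul c d => simp [h.mul_one]

end Builders

section Bialgebra

variable {k : Type u} {H : Type v} [Field k] [Ring H] [Bialgebra k H] {C : Type*} [AddCommGroup C]
  [Module k C] [Coalgebra k C]

/-- A coalgebra morphism to a bialgebra, as an element of the convolution algebra. -/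
def toConvHom (f : C →ₗc[k] H) : WithConv (C →ₗ[k] H) := pull f (toConv LinearMap.id)

/-- `((f ⊗ 1) * (1 ⊗ g)) x = f x₁ ⊗ g x₂`. -/
lemma convLeft_mul_convRight (f g : WithConv (C →ₗ[k] H)) (x : C) :
    (push (Algebra.TensorProduct.includeLeft : H →ₐ[k] H ⊗[k] H) f *
      push (Algebra.TensorProduct.includeRight : H →ₐ[k] H ⊗[k] H) g) x =
      TensorProduct.map f.ofConv g.ofConv (comul x) := by
  rw [LinearMap.convMul_apply]
  induction comul (R := k) x with
  | zero => simp
  | add a b ha hb => simp only [map_add, ha, hb]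
  | tmul a b => simp

/-- `((1 ⊗ g) * (f ⊗ 1)) x = f x₂ ⊗ g x₁`. -/
lemma convRight_mul_convLeft (f g : WithConv (C →ₗ[k] H)) (x : C) :
    (push (Algebra.TensorProduct.includeRight : H →ₐ[k] H ⊗[k] H) g *
      push (Algebra.TensorProduct.includeLeft : H →ₐ[k] H ⊗[k] H) f) x =
      TensorProduct.map f.ofConv g.ofConv (TensorProduct.comm k C C (comul x)) := by
  rw [LinearMap.convMul_apply]
  induction comul (R := k) x with
  | zero => simp
  | add a b ha hb => simp only [map_add, ha, hb]
  | tmul a b => simp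

end Bialgebra

/-! ### The right action determined by a left action on a Hopf algebra -/

section Hopf

variable {k : Type u} {H : Type v} [Field k] [Ring H] [HopfAlgebra k H] {C : Type*}
  [AddCommGroup C] [Module k C] [Coalgebra k C]

/-- `c ↦ T (f c)`, for the antipode `T`; it is the convolution inverse of `f`. -/
def invHom (f : C →ₗc[k] H) : WithConv (C →ₗ[k] H) :=
  pull f (toConv (HopfAlgebra.antipode k (A := H)))

lemma invHom_mul (f : C →ₗc[k] H) : invHom f * toConvHom f = 1 := by
  rw [invHom, toConvHom, ← map_mul, LinearMap.antipode_mul_id, map_one]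

lemma mul_invHom (f : C →ₗc[k] H) : toConvHom f * invHom f = 1 := by
  rw [invHom, toConvHom, ← map_mul, LinearMap.id_mul_antipode, map_one]

lemma toConvHom_left_cancel {f : C →ₗc[k] H} {g h : WithConv (C →ₗ[k] H)}
    (e : toConvHom f * g = toConvHom f * h) : g = h := by
  have e' := congr(invHom f * $e)
  rwa [← mul_assoc, ← mul_assoc, invHom_mul, one_mul, one_mul] at e'

lemma toConvHom_mulCoalgHom : toConvHom (Bialgebra.mulCoalgHom k H) =
    pull (fstC k H H) (toConv LinearMap.id) * pull (sndC k H H) (toConv LinearMap.id) :=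
  conv_ext_tmul fun x y ↦ by
    rw [pull_fst_mul_pull_snd_tmul]
    rfl

lemma push_comul_toConvHom (f : C →ₗc[k] H) :
    push (Bialgebra.comulAlgHom k H) (toConvHom f) =
      push Algebra.TensorProduct.includeLeft (toConvHom f) *
        push Algebra.TensorProduct.includeRight (toConvHom f) := by
  refine WithConv.ext (LinearMap.ext fun x ↦ ?_)
  exact (CoalgHomClass.map_comp_comul_apply f x).symm.trans (convLeft_mul_convRight _ _ x).symm

lemma push_comul_invHom (f : C →ₗc[k] H) :
    push (Bialgebra.comulAlgHom k H) (invHom f) =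
      push Algebra.TensorProduct.includeRight (invHom f) *
        push Algebra.TensorProduct.includeLeft (invHom f) := by
  refine left_inv_eq_right_inv (a := push (Bialgebra.comulAlgHom k H) (toConvHom f)) ?_ ?_
  · rw [← map_mul, invHom_mul, map_one]
  · rw [push_comul_toConvHom, mul_assoc, ← mul_assoc (push _ (toConvHom f)) (push _ (invHom f)),
      ← map_mul, mul_invHom, map_one, one_mul, ← map_mul, mul_invHom, map_one]

/-- The right action `x ↼ y := T (x₁ ⇀ y₁) • x₂ • y₂` of a left action `⇀` on a Hopf algebra with
antipode `T`. It is the unique map with `(x₁ ⇀ y₁) • (x₂ ↼ y₂) = x • y`. -/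
def rightOf (L : H ⊗[k] H →ₗc[k] H) : WithConv (H ⊗[k] H →ₗ[k] H) :=
  invHom L * toConvHom (Bialgebra.mulCoalgHom k H)

lemma toConvHom_mul_rightOf (L : H ⊗[k] H →ₗc[k] H) :
    toConvHom L * rightOf L = toConvHom (Bialgebra.mulCoalgHom k H) := by
  rw [rightOf, ← mul_assoc, mul_invHom, one_mul]

lemma eq_rightOf {L : H ⊗[k] H →ₗc[k] H} {R : WithConv (H ⊗[k] H →ₗ[k] H)}
    (h : toConvHom L * R = toConvHom (Bialgebra.mulCoalgHom k H)) : R = rightOf L :=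
  toConvHom_left_cancel (h.trans (toConvHom_mul_rightOf L).symm)

/-- The condition `(x₁ ⇀ y₁) ⊗ (x₂ ↼ y₂) = (x₂ ⇀ y₂) ⊗ (x₁ ↼ y₁)`, as commutation in a
convolution algebra. -/
lemma forall_comm_iff (L : H ⊗[k] H →ₗc[k] H) (R : WithConv (H ⊗[k] H →ₗ[k] H)) :
    (∀ x y : H, TensorProduct.map L.toLinearMap R.ofConv (comul (R := k) (x ⊗ₜ[k] y)) =
      TensorProduct.map L.toLinearMap R.ofConv
        (TensorProduct.comm k (H ⊗[k] H) (H ⊗[k] H) (comul (R := k) (x ⊗ₜ[k] y)))) ↔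
    push (Algebra.TensorProduct.includeLeft : H →ₐ[k] H ⊗[k] H) (toConvHom L) *
        push (Algebra.TensorProduct.includeRight : H →ₐ[k] H ⊗[k] H) R =
      push (Algebra.TensorProduct.includeRight : H →ₐ[k] H ⊗[k] H) R *
        push (Algebra.TensorProduct.includeLeft : H →ₐ[k] H ⊗[k] H) (toConvHom L) := by
  constructor
  · intro h
    refine conv_ext_tmul fun x y ↦ ?_
    rw [convLeft_mul_convRight, convRight_mul_convLeft]
    exact h x y
  · intro h x y
    have h' := congr($h (x ⊗ₜ y))
    rwa [convLeft_mul_convRight, convRight_mul_convLeft] at h'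

/-- `L ⊗ 1` commutes with `1 ⊗ R` if and only if `1 ⊗ L` commutes with `R ⊗ 1`. -/
lemma comm_swap_iff {f g : WithConv (C →ₗ[k] H)} :
    push (Algebra.TensorProduct.includeLeft : H →ₐ[k] H ⊗[k] H) f *
        push (Algebra.TensorProduct.includeRight : H →ₐ[k] H ⊗[k] H) g =
      push (Algebra.TensorProduct.includeRight : H →ₐ[k] H ⊗[k] H) g *
        push (Algebra.TensorProduct.includeLeft : H →ₐ[k] H ⊗[k] H) f ↔
    push (Algebra.TensorProduct.includeRight : H →ₐ[k] H ⊗[k] H) f *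
        push (Algebra.TensorProduct.includeLeft : H →ₐ[k] H ⊗[k] H) g =
      push (Algebra.TensorProduct.includeLeft : H →ₐ[k] H ⊗[k] H) g *
        push (Algebra.TensorProduct.includeRight : H →ₐ[k] H ⊗[k] H) f := by
  have hl (f : WithConv (C →ₗ[k] H)) :
      push (Algebra.TensorProduct.comm k H H).toAlgHom
        (push (Algebra.TensorProduct.includeLeft : H →ₐ[k] H ⊗[k] H) f) =
      push (Algebra.TensorProduct.includeRight : H →ₐ[k] H ⊗[k] H) f := rfl
  have hr (f : WithConv (C →ₗ[k] H)) :
      push (Algebra.TensorProduct.comm k H H).toAlgHom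
        (push (Algebra.TensorProduct.includeRight : H →ₐ[k] H ⊗[k] H) f) =
      push (Algebra.TensorProduct.includeLeft : H →ₐ[k] H ⊗[k] H) f := rfl
  constructor <;> intro h
  all_goals
    have h' := congr(push (Algebra.TensorProduct.comm k H H).toAlgHom $h)
    rwa [map_mul, map_mul, hl, hr] at h'

/-- If `⇀` and `↼` satisfy the commutation condition, then `↼` is a coalgebra morphism: in
`Δ ∘ R = (1 ⊗ L)⁻¹ * (L ⊗ 1)⁻¹ * (M ⊗ 1) * (1 ⊗ M) = (1 ⊗ L)⁻¹ * (R ⊗ 1) * (1 ⊗ M)` the first two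
factors commute. -/
def rightHom (L : H ⊗[k] H →ₗc[k] H)
    (hL : ∀ x y : H, TensorProduct.map L.toLinearMap (rightOf L).ofConv
        (comul (R := k) (x ⊗ₜ[k] y)) =
      TensorProduct.map L.toLinearMap (rightOf L).ofConv
        (TensorProduct.comm k (H ⊗[k] H) (H ⊗[k] H) (comul (R := k) (x ⊗ₜ[k] y)))) :
    H ⊗[k] H →ₗc[k] H where
  __ := (rightOf L).ofConv
  counit_comp := by
    have h (f : H ⊗[k] H →ₗc[k] H) : push (Bialgebra.counitAlgHom k H) (toConvHom f) = 1 := by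
      refine WithConv.ext (LinearMap.ext fun x ↦ ?_)
      exact CoalgHomClass.counit_comp_apply f x
    have h' : push (Bialgebra.counitAlgHom k H) (rightOf L) = 1 := by
      have e := congr(push (Bialgebra.counitAlgHom k H) $(toConvHom_mul_rightOf L))
      rwa [map_mul, h, h, one_mul] at e
    exact LinearMap.ext fun x ↦ congr($h' x)
  map_comp_comul := by
    have h : push (Bialgebra.comulAlgHom k H) (rightOf L) =
        push Algebra.TensorProduct.includeLeft (rightOf L) *
          push Algebra.TensorProduct.includeRight (rightOf L) := by
      have hc := comm_swap_iff.1 ((forall_comm_iff _ _).1 hL)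
      have hc' := congr(push Algebra.TensorProduct.includeRight (invHom L) * $hc *
        push Algebra.TensorProduct.includeRight (invHom L))
      simp only [← mul_assoc] at hc'
      rw [← map_mul, invHom_mul, map_one, one_mul, mul_assoc, ← map_mul, mul_invHom, map_one,
        mul_one] at hc'
      rw [rightOf, map_mul, push_comul_invHom, push_comul_toConvHom, mul_assoc,
        ← mul_assoc (push Algebra.TensorProduct.includeLeft (invHom L)), ← map_mul,
        ← mul_assoc, ← rightOf, ← hc', mul_assoc, ← map_mul, ← rightOf]
    refine LinearMap.ext fun x ↦ ?_
    exact (convLeft_mul_convRight _ _ x).symm.trans congr($h x).symm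

end Hopf

/-! ### Matched pairs of actions from a left action -/

section Hopf

variable {k : Type u} {H : Type v} [Field k] [Ring H] [HopfAlgebra k H]

/-- `x ⇀ (y • z) = (x₁ ⇀ y₁) • ((x₂ ↼ y₂) ⇀ z)`, as an identity in the convolution algebra of maps
`H ⊗ H ⊗ H → H`. -/
lemma pull_assoc_left_mul {L R : H ⊗[k] H →ₗc[k] H}
    (h : ∀ a b c : H, L (a ⊗ₜ (b * c)) =
      LinearMap.mul' k H (TensorProduct.map L.toLinearMap
        ((TensorProduct.curry L.toLinearMap).flip c ∘ₗ R.toLinearMap)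
        (comul (R := k) (a ⊗ₜ[k] b)))) :
    toConvHom (L.comp ((Coalgebra.TensorProduct.map (CoalgHom.id k H)
      (Bialgebra.mulCoalgHom k H)).comp
        (Coalgebra.TensorProduct.assoc k k H H H : (H ⊗[k] H) ⊗[k] H →ₗc[k] H ⊗[k] (H ⊗[k] H)))) =
    toConvHom (L.comp (fstC k (H ⊗[k] H) H)) *
      toConvHom (L.comp (Coalgebra.TensorProduct.map R (CoalgHom.id k H))) := by
  refine conv_ext_tmul fun t c ↦ ?_
  rw [show toConvHom (L.comp (fstC k (H ⊗[k] H) H)) = pull (fstC k (H ⊗[k] H) H) (toConvHom L)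
    from rfl, pull_fst_mul_tmul]
  induction t with
  | zero => simp
  | add s t hs ht => simp only [TensorProduct.add_tmul, map_add, hs, ht]
  | tmul a b => exact h a b c

/-- A left action `⇀` on a Hopf algebra `(H, •)` with `a ⇀ 1 = ε(a) 1` is part of a matched pair as
soon as the map `↼` determined by `x • y = (x₁ ⇀ y₁) • (x₂ ↼ y₂)` satisfies
`(x₁ ⇀ y₁) ⊗ (x₂ ↼ y₂) = (x₂ ⇀ y₂) ⊗ (x₁ ↼ y₁)` and
`x ⇀ (y • z) = (x₁ ⇀ y₁) • ((x₂ ↼ y₂) ⇀ z)`. The axioms of the right action are identities `F = G`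
that hold because `(L ∘ p) * F = (L ∘ p) * G` for the action `L` and a coalgebra morphism `p`. -/
def matchedPairOf (L : H ⊗[k] H →ₗc[k] H) (hL : ∀ x y : H,
      TensorProduct.map L.toLinearMap (rightOf L).ofConv (comul (R := k) (x ⊗ₜ[k] y)) =
      TensorProduct.map L.toLinearMap (rightOf L).ofConv
        (TensorProduct.comm k (H ⊗[k] H) (H ⊗[k] H) (comul (R := k) (x ⊗ₜ[k] y))))
    (one_left : ∀ a : H, L (1 ⊗ₜ a) = a)
    (mul_left : ∀ a b c : H, L ((a * b) ⊗ₜ c) = L (a ⊗ₜ L (b ⊗ₜ c)))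
    (left_one : ∀ a : H, L (a ⊗ₜ 1) = algebraMap k H (counit (R := k) a))
    (left_mul : ∀ a b c : H, L (a ⊗ₜ (b * c)) =
      LinearMap.mul' k H (TensorProduct.map L.toLinearMap
        ((TensorProduct.curry L.toLinearMap).flip c ∘ₗ (rightHom L hL).toLinearMap)
        (comul (R := k) (a ⊗ₜ[k] b)))) : MatchedPairStruct k H where
  left := L
  right := rightHom L hL
  one_left := one_left
  mul_left := mul_left
  left_one := left_one
  left_mul := left_mul
  right_one a := by
    let j : H →ₗc[k] H ⊗[k] H :=
      tmulRight (e := (1 : H)) (Bialgebra.comul_one.trans rfl) Bialgebra.counit_one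
    have h := congr(pull j $(toConvHom_mul_rightOf L))
    have hl : pull j (toConvHom L) = 1 := WithConv.ext (LinearMap.ext left_one)
    rw [map_mul, hl, one_mul] at h
    exact congr($h a).trans (mul_one a)
  one_right a := by
    let j : H →ₗc[k] H ⊗[k] H :=
      tmulLeft (e := (1 : H)) (Bialgebra.comul_one.trans rfl) Bialgebra.counit_one
    have h := congr(pull j $(toConvHom_mul_rightOf L))
    have hl : pull j (toConvHom L) = toConvHom (CoalgHom.id k H) :=
      WithConv.ext (LinearMap.ext one_left)
    have hm : pull j (toConvHom (Bialgebra.mulCoalgHom k H)) = toConvHom (CoalgHom.id k H) * 1 := by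
      rw [mul_one]
      exact WithConv.ext (LinearMap.ext fun x ↦ one_mul x)
    rw [map_mul, hl, hm] at h
    exact congr($(toConvHom_left_cancel h) a)
  right_mul a b c := by
    have hLR : toConvHom L * toConvHom (rightHom L hL) = toConvHom (Bialgebra.mulCoalgHom k H) :=
      toConvHom_mul_rightOf L
    let u : (H ⊗[k] H) ⊗[k] H →ₗc[k] H ⊗[k] H := (Coalgebra.TensorProduct.map (CoalgHom.id k H)
      (Bialgebra.mulCoalgHom k H)).comp
        (Coalgebra.TensorProduct.assoc k k H H H : (H ⊗[k] H) ⊗[k] H →ₗc[k] H ⊗[k] (H ⊗[k] H))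
    let v : (H ⊗[k] H) ⊗[k] H →ₗc[k] H ⊗[k] H :=
      Coalgebra.TensorProduct.map (rightHom L hL) (CoalgHom.id k H)
    let w : (H ⊗[k] H) ⊗[k] H →ₗc[k] H ⊗[k] H := fstC k (H ⊗[k] H) H
    have hu : pull u (toConvHom L) = pull w (toConvHom L) * pull v (toConvHom L) :=
      pull_assoc_left_mul left_mul
    have hMu : pull u (toConvHom (Bialgebra.mulCoalgHom k H)) =
        pull w (toConvHom (Bialgebra.mulCoalgHom k H)) *
          pull (sndC k (H ⊗[k] H) H) (toConv LinearMap.id) := by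
      refine conv_ext_tmul fun t c ↦ ?_
      rw [pull_fst_mul_pull_snd_tmul]
      induction t with
      | zero => simp
      | add s t hs ht => simp only [TensorProduct.add_tmul, map_add, add_mul, hs, ht]
      | tmul a b => exact (mul_assoc a b c).symm
    have hMv : pull v (toConvHom (Bialgebra.mulCoalgHom k H)) =
        pull w (toConvHom (rightHom L hL)) *
          pull (sndC k (H ⊗[k] H) H) (toConv LinearMap.id) := by
      refine conv_ext_tmul fun t c ↦ ?_
      rw [pull_fst_mul_pull_snd_tmul]
      rfl
    have e : pull u (toConvHom L) * pull u (toConvHom (rightHom L hL)) =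
        pull u (toConvHom L) * pull v (toConvHom (rightHom L hL)) := by
      rw [← map_mul, hLR, hMu, hu, mul_assoc, ← map_mul, hLR, hMv, ← mul_assoc, ← map_mul, hLR]
    have e' : pull u (toConvHom (rightHom L hL)) = pull v (toConvHom (rightHom L hL)) :=
      toConvHom_left_cancel (f := L.comp u) e
    exact congr($e' ((a ⊗ₜ b) ⊗ₜ c))
  mul_right a b c := by
    have hLR : toConvHom L * toConvHom (rightHom L hL) = toConvHom (Bialgebra.mulCoalgHom k H) :=
      toConvHom_mul_rightOf L
    let t : H ⊗[k] (H ⊗[k] H) →ₗc[k] H ⊗[k] H := (Coalgebra.TensorProduct.map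
      (Bialgebra.mulCoalgHom k H) (CoalgHom.id k H)).comp
        ((Coalgebra.TensorProduct.assoc k k H H H).symm :
          H ⊗[k] (H ⊗[k] H) →ₗc[k] (H ⊗[k] H) ⊗[k] H)
    let s : H ⊗[k] (H ⊗[k] H) →ₗc[k] H ⊗[k] H :=
      Coalgebra.TensorProduct.map (CoalgHom.id k H) L
    let w : H ⊗[k] (H ⊗[k] H) →ₗc[k] H ⊗[k] H := sndC k H (H ⊗[k] H)
    have ht : pull t (toConvHom L) = pull s (toConvHom L) := by
      refine WithConv.ext (TensorProduct.ext_threefold' fun a b c ↦ ?_)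
      exact mul_left a b c
    have hMt : pull t (toConvHom (Bialgebra.mulCoalgHom k H)) =
        pull (fstC k H (H ⊗[k] H)) (toConv LinearMap.id) *
          pull w (toConvHom (Bialgebra.mulCoalgHom k H)) := by
      refine conv_ext_tmul fun a t ↦ ?_
      rw [pull_fst_mul_pull_snd_tmul]
      induction t with
      | zero => simp
      | add s t hs ht => simp only [TensorProduct.tmul_add, map_add, mul_add, hs, ht]
      | tmul b c => exact mul_assoc a b c
    have hMs : pull s (toConvHom (Bialgebra.mulCoalgHom k H)) =
        pull (fstC k H (H ⊗[k] H)) (toConv LinearMap.id) * pull w (toConvHom L) := by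
      refine conv_ext_tmul fun a t ↦ ?_
      rw [pull_fst_mul_pull_snd_tmul]
      rfl
    have e : pull t (toConvHom L) * pull t (toConvHom (rightHom L hL)) =
        pull t (toConvHom L) *
          (pull s (toConvHom (rightHom L hL)) * pull w (toConvHom (rightHom L hL))) := by
      rw [← map_mul, hLR, hMt, ht, ← mul_assoc, ← map_mul, hLR, hMs, mul_assoc, ← map_mul, hLR]
    have e' : pull t (toConvHom (rightHom L hL)) =
        pull s (toConvHom (rightHom L hL)) * pull w (toConvHom (rightHom L hL)) :=
      toConvHom_left_cancel (f := L.comp t) e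
    have e'' := congr($e' (a ⊗ₜ (b ⊗ₜ c)))
    rw [mul_pull_snd_tmul] at e''
    exact e''
  mul_eq a b := congr($(toConvHom_mul_rightOf L) (a ⊗ₜ b)).symm

end Hopf

/-! ### The matched pair of actions of a Yetter--Drinfeld post-Hopf algebra -/

section Hopf

variable {k : Type u} {H : Type v} [Field k] [Ring H] [HopfAlgebra k H]

/-- Both sides state that `x ⇀ (y • z) = (x₁ ⇀ y₁) • ((x₂ ↼ y₂) ⇀ z)`. -/
lemma forall_left_mul_iff (L R : H ⊗[k] H →ₗc[k] H) :
    (∀ a b c : H, L (a ⊗ₜ (b * c)) =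
      LinearMap.mul' k H (TensorProduct.map L.toLinearMap
        ((TensorProduct.curry L.toLinearMap).flip c ∘ₗ R.toLinearMap)
        (comul (R := k) (a ⊗ₜ[k] b)))) ↔
    pull (fstC k H H) (actOp L) * pull (sndC k H H) (mulOp k H) =
      pull L (mulOp k H) * pull R (actOp L) := by
  have h (a b c : H) : (pull L (mulOp k H) * pull R (actOp L)) (a ⊗ₜ b) c =
      LinearMap.mul' k H (TensorProduct.map L.toLinearMap
        ((TensorProduct.curry L.toLinearMap).flip c ∘ₗ R.toLinearMap)
        (comul (R := k) (a ⊗ₜ[k] b))) := by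
    rw [LinearMap.convMul_apply]
    induction comul (R := k) (a ⊗ₜ[k] b) with
    | zero => simp
    | add s t hs ht => simp only [map_add, LinearMap.add_apply, hs, ht]
    | tmul s t => rfl
  constructor
  · intro H'
    refine conv_ext_tmul fun x y ↦ LinearMap.ext fun z ↦ ?_
    rw [h, pull_fst_mul_pull_snd_tmul, ← H']
    rfl
  · intro e x y z
    rw [← h, ← e, pull_fst_mul_pull_snd_tmul]
    rfl

/-- A left action of an algebra, as a homomorphism to the algebra of endomorphisms. -/
def actAlgHom (L : H ⊗[k] H →ₗc[k] H) (one_left : ∀ a : H, L (1 ⊗ₜ a) = a)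
    (mul_left : ∀ a b c : H, L ((a * b) ⊗ₜ c) = L (a ⊗ₜ L (b ⊗ₜ c))) : H →ₐ[k] Module.End k H :=
  AlgHom.ofLinearMap (TensorProduct.curry L.toLinearMap) (LinearMap.ext one_left)
    fun a b ↦ LinearMap.ext (mul_left a b)

/-- If `x • y = x₁ · (x₂ ⇀ y)` and `x ⇀ (y · z) = (x₁ ⇀ y) · (x₂ ⇀ z)`, then
`x ⇀ (y • z) = (x₁ ⇀ y₁) • ((x₂ ↼ y₂) ⇀ z)`. -/
lemma left_mul_of_act_mul {L : H ⊗[k] H →ₗc[k] H} (one_left : ∀ a : H, L (1 ⊗ₜ a) = a)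
    (mul_left : ∀ a b c : H, L ((a * b) ⊗ₜ c) = L (a ⊗ₜ L (b ⊗ₜ c)))
    {l : WithConv (H →ₗ[k] Module.End k H)} (hl : l * actOp L = mulOp k H)
    (act_mul : pull (fstC k H H) (actOp L) * pull (sndC k H H) l =
      pull L l * pull (fstC k H H) (actOp L)) {R : H ⊗[k] H →ₗc[k] H}
    (hR : toConvHom L * toConvHom R = toConvHom (Bialgebra.mulCoalgHom k H)) :
    pull (fstC k H H) (actOp L) * pull (sndC k H H) (mulOp k H) =
      pull L (mulOp k H) * pull R (actOp L) := by
  have h : pull L (actOp L) * pull R (actOp L) =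
      pull (fstC k H H) (actOp L) * pull (sndC k H H) (actOp L) := by
    have hR' := congr(push (actAlgHom L one_left mul_left) $hR)
    rw [toConvHom_mulCoalgHom, map_mul, map_mul] at hR'
    exact hR'
  rw [← hl, map_mul, ← mul_assoc, act_mul, mul_assoc, ← h, ← mul_assoc, ← map_mul, hl]

end Hopf

namespace IsHopfMul

variable {k : Type u} {H : Type v} [Field k] [AddCommGroup H] [Module k H] [Coalgebra k H]
  {m : H →ₗ[k] Module.End k H} {e : H} {S : H →ₗ[k] H} (h : IsHopfMul m e S)

lemma rightOf_eq (L : H ⊗[k] H →ₗc[k] H) :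
    (@rightOf k H _ h.ring h.hopfAlgebra L).ofConv =
      TensorProduct.lift m ∘ₗ TensorProduct.map (S ∘ₗ L.toLinearMap) (TensorProduct.lift m) ∘ₗ
        comul := by
  let := h.ring
  let := h.hopfAlgebra
  have hm : TensorProduct.lift m = LinearMap.mul' k H := TensorProduct.ext' fun x y ↦ rfl
  rw [hm]
  rfl

/-- The matched pair of actions on the Hopf algebra `(H, •)` given by a left action `⇀` and a
decomposition `x • y = x₁ · (x₂ ⇀ y)` with `x ⇀ (y · z) = (x₁ ⇀ y) · (x₂ ⇀ z)`. -/
def matchedPair (L : H ⊗[k] H →ₗc[k] H)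
    (hL : ∀ x y : H,
      TensorProduct.map L.toLinearMap (TensorProduct.lift m ∘ₗ
        TensorProduct.map (S ∘ₗ L.toLinearMap) (TensorProduct.lift m) ∘ₗ comul)
        (comul (R := k) (x ⊗ₜ[k] y)) =
      TensorProduct.map L.toLinearMap (TensorProduct.lift m ∘ₗ
        TensorProduct.map (S ∘ₗ L.toLinearMap) (TensorProduct.lift m) ∘ₗ comul)
        (TensorProduct.comm k (H ⊗[k] H) (H ⊗[k] H) (comul (R := k) (x ⊗ₜ[k] y))))
    (one_left : ∀ a : H, L (e ⊗ₜ a) = a)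
    (mul_left : ∀ a b c : H, L (m a b ⊗ₜ c) = L (a ⊗ₜ L (b ⊗ₜ c)))
    (left_one : ∀ a : H, L (a ⊗ₜ e) = counit (R := k) a • e)
    {l : WithConv (H →ₗ[k] Module.End k H)} (hl : l * actOp L = toConv m)
    (act_mul : pull (fstC k H H) (actOp L) * pull (sndC k H H) l =
      pull L l * pull (fstC k H H) (actOp L)) :
    @MatchedPairStruct k H _ h.ring h.hopfAlgebra.toBialgebra :=
  letI := h.ring
  letI := h.hopfAlgebra
  have hL' := by
    rw [← h.rightOf_eq] at hL
    exact hL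
  matchedPairOf L hL' one_left mul_left
    (fun a ↦ (left_one a).trans (Algebra.algebraMap_eq_smul_one _).symm)
    ((forall_left_mul_iff L _).2 (left_mul_of_act_mul one_left mul_left hl act_mul
      (toConvHom_mul_rightOf L)))

end IsHopfMul

namespace YDPostHopfStruct

variable {k : Type u} {H : Type v} [Field k] [Ring H] [Algebra k H] [Coalgebra k H]
  (X : YDPostHopfStruct k H)

lemma isAlgMul_bullet : IsAlgMul X.bulletOp.ofConv 1 where
  one_mul := X.bulletOp_one_left
  mul_one := X.bulletOp_one_right
  mul_assoc := X.bulletOp_assoc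

lemma isHopfMul_bullet :
    IsHopfMul X.bulletOp.ofConv 1 (subAntipode X.beta X.antipode) where
  __ := X.isAlgMul_bullet
  comul_mul := X.comul_comp_bulletOp
  counit_mul x y := by
    rw [bulletOp_apply]
    exact X.counit_bullet x y
  comul_one := X.comul_one
  counit_one := X.counit_one
  mul_antipode := X.bulletOp_subAntipode
  antipode_mul := X.isAlgMul_bullet.antipode_mul X.bulletOp_subAntipode
    (G := toConv X.beta * push (Algebra.lmul k H) (toConv X.antipode)) (by
      change _ * (mulOp k H * actOp X.act) = 1
      rw [mul_assoc, ← mul_assoc _ (mulOp k H), antipode_mul_mulOp, one_mul, beta_mul_actOp])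

/-- The ring `(H, •, 1)`. -/
abbrev bulletRing : Ring H := X.isHopfMul_bullet.ring

/-- The Hopf algebra `(H, •, 1, Δ, ε, S')`. -/
abbrev bulletHopf : @HopfAlgebra k H _ X.bulletRing.toSemiring := X.isHopfMul_bullet.hopfAlgebra

lemma rightAct_eq :
    rightAct X.act.toLinearMap X.beta X.antipode =
      TensorProduct.lift X.bulletOp.ofConv ∘ₗ
        TensorProduct.map (subAntipode X.beta X.antipode ∘ₗ X.act.toLinearMap)
          (TensorProduct.lift X.bulletOp.ofConv) ∘ₗ comul := by
  have h : bullet X.act.toLinearMap = TensorProduct.lift X.bulletOp.ofConv :=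
    TensorProduct.ext' fun x y ↦ (X.bulletOp_apply x y).symm
  rw [rightAct, h]

/-- The matched pair of actions of a Yetter--Drinfeld post-Hopf algebra. -/
def matchedPair : @MatchedPairStruct k H _ X.bulletRing X.bulletHopf.toBialgebra :=
  X.isHopfMul_bullet.matchedPair X.act
    (by
      rw [← rightAct_eq]
      exact X.act_tmul_rightAct)
    X.one_act
    (fun a b c ↦ by
      rw [bulletOp_apply]
      exact (X.act_act a b c).symm)
    X.act_one (l := mulOp k H) rfl X.act_mul_conv

end YDPostHopfStruct

/-! ### The Yetter--Drinfeld post-Hopf algebra of a matched pair of actions -/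

section Builder

variable {k : Type u} {H : Type v} [Field k] [AddCommGroup H] [Module k H] [Coalgebra k H]

/-- The Yetter--Drinfeld post-Hopf algebra with product `x · y = m x y`, given by conditions on
`m` in the convolution algebra, where `n x y = x₁ · (x₂ ⇀ y)`. -/
def IsAlgMul.postHopf {m : H →ₗ[k] Module.End k H} {e : H} (h : IsAlgMul m e)
    (act : H ⊗[k] H →ₗc[k] H) (β : H →ₗ[k] Module.End k H) (S : H →ₗ[k] H)
    (n : H →ₗ[k] Module.End k H) (hn : toConv m * actOp act = toConv n)
    (mul_antipode : bconv LinearMap.id m S = counit.smulRight e)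
    (antipode_mul : ∀ x, TensorProduct.lift (m ∘ₗ S) (comul x) = counit (R := k) x • e)
    (act_mul : pull (fstC k H H) (actOp act) * pull (sndC k H H) (toConv m) =
      pull act (toConv m) * pull (fstC k H H) (actOp act))
    (act_act : ∀ x y z, act (x ⊗ₜ act (y ⊗ₜ z)) = act (n x y ⊗ₜ z))
    (act_beta : actOp act * toConv β = 1) (beta_act : toConv β * actOp act = 1)
    (counit_mul : ∀ x y, counit (R := k) (m x y) = counit (R := k) x * counit (R := k) y)
    (counit_one : counit (R := k) e = 1) (comul_one : comul (R := k) e = e ⊗ₜ e)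
    (comul_mul : ∀ x, comul ∘ₗ m x =
      (onLeft (toConv n) * onRight (toConv m) * onLeft (toConv β)) x ∘ₗ comul)
    (comul_subAntipode : ∀ x, comul (R := k) (bconv LinearMap.id β S x) =
      TensorProduct.map (bconv LinearMap.id β S) (bconv LinearMap.id β S)
        (TensorProduct.comm k H H (comul x)))
    (act_tmul : ∀ x y : H,
      TensorProduct.map act.toLinearMap (TensorProduct.lift n ∘ₗ
        TensorProduct.map (bconv LinearMap.id β S ∘ₗ act.toLinearMap) (TensorProduct.lift n) ∘ₗ
          comul) (comul (R := k) (x ⊗ₜ[k] y)) =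
      TensorProduct.map act.toLinearMap (TensorProduct.lift n ∘ₗ
        TensorProduct.map (bconv LinearMap.id β S ∘ₗ act.toLinearMap) (TensorProduct.lift n) ∘ₗ
          comul)
        (TensorProduct.comm k (H ⊗[k] H) (H ⊗[k] H) (comul (R := k) (x ⊗ₜ[k] y)))) :
    @YDPostHopfStruct k H _ h.ring h.algebra ‹_› :=
  have hc (x y : H) : comul (m x y) = (onLeft (toConv m) * ((onLeft (actOp act) *
      onRight (toConv m)) * onLeft (toConv β))) x (comul y) := by
    refine congr($(comul_mul x) y).trans ?_
    rw [← hn, onLeft_mul]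
    simp only [_root_.mul_assoc]
    rfl
  letI := h.ring
  letI := h.algebra
  letI : Coalgebra k H := ‹Coalgebra k H›
  have hb : bullet act.toLinearMap = TensorProduct.lift n := by
    refine TensorProduct.ext' fun x y ↦ (bullet_tmul _ x y).trans ?_
    exact congr($hn x y)
  { antipode := S
    act := act
    beta := β
    mul_antipode := by
      intro x
      refine Eq.trans ?_ (congr($mul_antipode x).trans (Algebra.algebraMap_eq_smul_one _).symm)
      simp only [LinearMap.comp_apply, bconv]
      induction comul (R := k) x with
      | zero => simp
      | add c d hc hd => simp only [map_add, hc, hd]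
      | tmul c d => rfl
    antipode_mul := by
      intro x
      refine Eq.trans ?_ ((antipode_mul x).trans (Algebra.algebraMap_eq_smul_one _).symm)
      induction comul (R := k) x with
      | zero => simp
      | add c d hc hd => simp only [map_add, hc, hd]
      | tmul c d => rfl
    act_mul := (forall_act_mul_iff act).2 act_mul
    act_act := by
      rw [hb]
      exact act_act
    act_beta := by
      intro x
      refine (congr($act_beta x) : _).trans ?_
      exact Algebra.algebraMap_eq_smul_one (A := Module.End k H) (counit (R := k) x)
    beta_act := by
      intro x
      refine (congr($beta_act x) : _).trans ?_
      exact Algebra.algebraMap_eq_smul_one (A := Module.End k H) (counit (R := k) x)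
    counit_mul := counit_mul
    counit_one := counit_one
    comul_one := comul_one
    comul_mul := by
      intro x y
      rw [twistedComulMul_tmul]
      exact hc x y
    comul_subAntipode := comul_subAntipode
    act_tmul_rightAct := by
      rw [rightAct, hb]
      exact act_tmul }

end Builder

namespace MatchedPairStruct

variable {k : Type u} {H : Type v} [Field k] [Ring H] [HopfAlgebra k H]
  (M : MatchedPairStruct k H)

/-- The left action as a homomorphism to the algebra of endomorphisms. -/
def leftAlgHom : H →ₐ[k] Module.End k H := actAlgHom M.left M.one_left M.mul_left

lemma actOp_eq_push : actOp M.left = push M.leftAlgHom (toConv LinearMap.id) := rfl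

/-- The map `β x = (T x ⇀ -)`. -/
def beta : WithConv (H →ₗ[k] Module.End k H) :=
  push M.leftAlgHom (toConv (HopfAlgebra.antipode k (A := H)))

lemma actOp_mul_beta : actOp M.left * M.beta = 1 := by
  rw [actOp_eq_push, beta, ← map_mul, LinearMap.id_mul_antipode, map_one]

lemma beta_mul_actOp : M.beta * actOp M.left = 1 := by
  rw [actOp_eq_push, beta, ← map_mul, LinearMap.antipode_mul_id, map_one]

/-- The map `x ↦ (x · -)`, for the product `x · y = x₁ • (T x₂ ⇀ y)`. -/
def dotOp : WithConv (H →ₗ[k] Module.End k H) := mulOp k H * M.beta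

lemma dotOp_mul_actOp : M.dotOp * actOp M.left = mulOp k H := by
  rw [dotOp, mul_assoc, beta_mul_actOp, mul_one]

lemma toConvHom_mul_right :
    toConvHom M.left * toConvHom M.right = toConvHom (Bialgebra.mulCoalgHom k H) :=
  conv_ext_tmul fun x y ↦ (M.mul_eq x y).symm

lemma act_mul_conv : pull (fstC k H H) (actOp M.left) * pull (sndC k H H) M.dotOp =
    pull M.left M.dotOp * pull (fstC k H H) (actOp M.left) := by
  have h₁ := (forall_left_mul_iff M.left M.right).1 M.left_mul
  have h₂ : pull M.left (actOp M.left) * pull M.right (actOp M.left) =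
      pull (fstC k H H) (actOp M.left) * pull (sndC k H H) (actOp M.left) := by
    have h := congr(push M.leftAlgHom $(M.toConvHom_mul_right))
    rw [toConvHom_mulCoalgHom, map_mul, map_mul] at h
    exact h
  have h₃ : pull M.right (actOp M.left) * pull (sndC k H H) M.beta =
      pull M.left M.beta * pull (fstC k H H) (actOp M.left) := by
    have h := congr(pull M.left M.beta * $h₂ * pull (sndC k H H) M.beta)
    rw [← mul_assoc, ← map_mul, beta_mul_actOp, map_one, one_mul, mul_assoc, mul_assoc,
      ← map_mul (pull (sndC k H H)), actOp_mul_beta, map_one, mul_one] at h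
    exact h
  rw [dotOp, map_mul, ← mul_assoc, h₁, mul_assoc, h₃, ← mul_assoc, ← map_mul]

/-- `(x • y) · z = x₁ · ((x₂ ⇀ y) · z)`. -/
lemma dotOp_mul : pull (Bialgebra.mulCoalgHom k H) M.dotOp =
    pull (fstC k H H) M.dotOp * pull M.left M.dotOp := by
  have hm : pull (Bialgebra.mulCoalgHom k H) (mulOp k H) =
      pull (fstC k H H) (mulOp k H) * pull (sndC k H H) (mulOp k H) := by
    have h := congr(push (Algebra.lmul k H) $(toConvHom_mulCoalgHom (k := k) (H := H)))
    rw [map_mul] at h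
    exact h
  have ha : pull (Bialgebra.mulCoalgHom k H) (actOp M.left) =
      pull (fstC k H H) (actOp M.left) * pull (sndC k H H) (actOp M.left) := by
    have h := congr(push M.leftAlgHom $(toConvHom_mulCoalgHom (k := k) (H := H)))
    rw [map_mul] at h
    exact h
  have hb : pull (Bialgebra.mulCoalgHom k H) M.beta =
      pull (sndC k H H) M.beta * pull (fstC k H H) M.beta := by
    refine left_inv_eq_right_inv (a := pull (Bialgebra.mulCoalgHom k H) (actOp M.left)) ?_ ?_
    · rw [← map_mul, beta_mul_actOp, map_one]
    · rw [ha, mul_assoc, ← mul_assoc (pull (sndC k H H) _), ← map_mul, actOp_mul_beta, map_one,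
        one_mul, ← map_mul, actOp_mul_beta, map_one]
  calc pull (Bialgebra.mulCoalgHom k H) M.dotOp
      = pull (fstC k H H) (mulOp k H) * (pull (sndC k H H) M.dotOp * pull (fstC k H H) M.beta) := by
        rw [dotOp, map_mul, map_mul, hm, hb]
        simp only [mul_assoc]
    _ = pull (fstC k H H) M.dotOp * ((pull (fstC k H H) (actOp M.left) *
          pull (sndC k H H) M.dotOp) * pull (fstC k H H) M.beta) := by
        rw [← M.dotOp_mul_actOp, map_mul]
        simp only [mul_assoc]
    _ = _ := by
        rw [act_mul_conv, mul_assoc, ← map_mul, actOp_mul_beta, map_one, mul_one]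

lemma dotOp_assoc (x y : H) : M.dotOp (M.dotOp x y) = M.dotOp x * M.dotOp y := by
  -- the two sides agree after convolution with `α`, which is invertible
  let μ : (H →ₗ[k] Module.End k H) →ₗ[k] Module.End k H →ₗ[k] H →ₗ[k] Module.End k H :=
    LinearMap.llcomp k H H (Module.End k H)
  let P : H →ₗ[k] H →ₗ[k] Module.End k H := μ M.dotOp.ofConv ∘ₗ M.dotOp.ofConv
  let Q : H →ₗ[k] H →ₗ[k] Module.End k H :=
    (LinearMap.mul k (Module.End k H)).compl₁₂ M.dotOp.ofConv M.dotOp.ofConv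
  have hμ (F : H →ₗ[k] H →ₗ[k] Module.End k H) :
      bconv μ (bconv μ F (actOp M.left).ofConv) M.beta.ofConv = F := by
    rw [bconv_assoc (ν := LinearMap.mul k (Module.End k H)) (ν' := μ) (fun u v w ↦ rfl), bconv_mul,
      actOp_mul_beta, ofConv_one, bconv_counit_right (fun v ↦ rfl)]
  have hP : bconv μ P (actOp M.left).ofConv = bconv μ Q (actOp M.left).ofConv := by
    ext x y : 2
    have h₁ : bconv μ P (actOp M.left).ofConv x y = M.dotOp (mulOp k H x y) := by
      rw [← dotOp_mul_actOp, LinearMap.convMul_apply]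
      simp only [bconv, LinearMap.comp_apply]
      induction comul (R := k) x with
      | zero => simp
      | add c d hc hd => simp only [map_add, LinearMap.add_apply, hc, hd]
      | tmul c d => rfl
    have h₂ : bconv μ Q (actOp M.left).ofConv x y =
        (pull (fstC k H H) M.dotOp * pull M.left M.dotOp) (x ⊗ₜ y) := by
      rw [pull_fst_mul_tmul]
      simp only [bconv, LinearMap.comp_apply]
      induction comul (R := k) x with
      | zero => simp
      | add c d hc hd => simp only [map_add, LinearMap.add_apply, hc, hd]
      | tmul c d => rfl
    rw [h₁, h₂, ← dotOp_mul]
    rfl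
  have hPQ : P = Q := by rw [← hμ P, hP, hμ]
  exact congr($hPQ x y)

lemma isAlgMul_dot : IsAlgMul M.dotOp.ofConv 1 where
  one_mul y := by
    rw [dotOp, LinearMap.convMul_apply, Bialgebra.comul_one, Algebra.TensorProduct.one_def]
    change 1 * M.left (HopfAlgebra.antipode k (1 : H) ⊗ₜ y) = y
    rw [HopfAlgebra.antipode_one, M.one_left, one_mul]
  mul_one x := by
    have h : (M.dotOp).ofConv.flip 1 =
        bconv (LinearMap.mul k H) LinearMap.id (counit.smulRight (1 : H)) := by
      ext x
      change M.dotOp x 1 = _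
      rw [dotOp, LinearMap.convMul_apply]
      simp only [bconv, LinearMap.comp_apply]
      induction comul (R := k) x with
      | zero => simp
      | add a b ha hb => simp only [map_add, LinearMap.add_apply, ha, hb]
      | tmul a b =>
        change a * M.left (HopfAlgebra.antipode k b ⊗ₜ 1) = _
        simp [M.left_one, Algebra.algebraMap_eq_smul_one]
    rw [bconv_counit_right (fun v ↦ mul_one v)] at h
    exact congr($h x)
  mul_assoc := M.dotOp_assoc

/-- The map `S x = x₁ ⇀ T x₂`. -/
def dotAntipode : H →ₗ[k] H :=
  bconv LinearMap.id (actOp M.left).ofConv (HopfAlgebra.antipode k)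

lemma beta_dotAntipode :
    bconv LinearMap.id M.beta.ofConv M.dotAntipode = HopfAlgebra.antipode k := by
  rw [dotAntipode, ← bconv_assoc (μ := LinearMap.mul k (Module.End k H)) (μ' := LinearMap.id)
    (fun u v w ↦ rfl), bconv_mul, beta_mul_actOp, ofConv_one, bconv_counit_left (fun v ↦ rfl)]

lemma dot_mul_antipode :
    bconv LinearMap.id M.dotOp.ofConv M.dotAntipode = counit.smulRight 1 := by
  rw [dotAntipode, ← bconv_assoc (μ := LinearMap.mul k (Module.End k H)) (μ' := LinearMap.id)
    (fun u v w ↦ rfl), bconv_mul, dotOp_mul_actOp]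
  refine Eq.trans ?_ ((bconv_mul (toConv LinearMap.id) (toConv (HopfAlgebra.antipode k))).trans ?_)
  · rfl
  · rw [LinearMap.id_mul_antipode, ofConv_one]

lemma antipode_mul_dot (x : H) :
    TensorProduct.lift (M.dotOp.ofConv ∘ₗ M.dotAntipode) (comul x) =
      counit (R := k) x • (1 : H) := by
  refine M.isAlgMul_dot.antipode_mul M.dot_mul_antipode
    (G := actOp M.left * push (Algebra.lmul k H) (toConv (HopfAlgebra.antipode k))) ?_ x
  change _ * (mulOp k H * M.beta) = 1
  rw [mul_assoc, ← mul_assoc _ (mulOp k H), mulOp_eq_push, ← map_mul, LinearMap.antipode_mul_id,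
    map_one, one_mul, actOp_mul_beta]

lemma comul_comp_mulOp (x : H) : comul ∘ₗ mulOp k H x =
    (onLeft (mulOp k H) * onRight (mulOp k H)) x ∘ₗ comul := by
  ext y
  refine (Bialgebra.comul_mul x y).trans ?_
  rw [LinearMap.comp_apply]
  induction comul (R := k) y with
  | zero => simp
  | add a b ha hb => simp only [map_add, mul_add, ha, hb]
  | tmul a b =>
    rw [onLeft_mul_onRight_tmul]
    induction comul (R := k) x with
    | zero => simp
    | add c d hc hd => simp only [map_add, add_mul, hc, hd]
    | tmul c d => exact Algebra.TensorProduct.tmul_mul_tmul c a d b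

lemma comul_comp_beta (x : H) : comul ∘ₗ M.beta x =
    (onRight M.beta * onLeft M.beta) x ∘ₗ comul := by
  -- `x ↦ (x₁ ⇀ -) ⊗ (x₂ ⇀ -)` is an action of `H` on `H ⊗ H`
  let A : H →ₐ[k] Module.End k (H ⊗[k] H) :=
    (Module.endTensorEndAlgHom (R := k) (S := k) (A := k) (M := H) (N := H)).comp
      ((Algebra.TensorProduct.map M.leftAlgHom M.leftAlgHom).comp (Bialgebra.comulAlgHom k H))
  have hA : push A (toConv LinearMap.id) = onLeft (actOp M.left) * onRight (actOp M.left) := by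
    refine WithConv.ext (LinearMap.ext fun x ↦ TensorProduct.ext' fun v w ↦ ?_)
    rw [onLeft_mul_onRight_tmul]
    change Module.endTensorEndAlgHom (Algebra.TensorProduct.map M.leftAlgHom M.leftAlgHom
      (comul x)) (v ⊗ₜ w) = _
    induction comul (R := k) x with
    | zero => simp
    | add c d hc hd => simp only [map_add, LinearMap.add_apply, hc, hd]
    | tmul c d => rfl
  have hT : push A (toConv (HopfAlgebra.antipode k)) = onRight M.beta * onLeft M.beta := by
    refine left_inv_eq_right_inv (a := push A (toConv LinearMap.id)) ?_ ?_
    · rw [← map_mul, LinearMap.antipode_mul_id, map_one]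
    · rw [hA, mul_assoc, ← mul_assoc (onRight (actOp M.left)), ← onRight_mul, actOp_mul_beta,
        onRight_one, one_mul, ← onLeft_mul, actOp_mul_beta, onLeft_one]
  rw [← hT]
  refine (comul_comp_actOp M.left (HopfAlgebra.antipode k x)).trans ?_
  rw [← hA]
  rfl

lemma comul_comp_dotOp (x : H) : comul ∘ₗ M.dotOp x =
    (onLeft (mulOp k H) * onRight M.dotOp * onLeft M.beta) x ∘ₗ comul := by
  have h := comp_convMul_eq comul_comp_mulOp M.comul_comp_beta x
  have e : onLeft (mulOp k H) * onRight (mulOp k H) * (onRight M.beta * onLeft M.beta) =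
      onLeft (mulOp k H) * onRight M.dotOp * onLeft M.beta := by
    rw [dotOp, onRight_mul]
    simp only [mul_assoc]
  rwa [e] at h

lemma counit_dotOp (x y : H) :
    counit (R := k) (M.dotOp x y) = counit (R := k) x * counit (R := k) y := by
  refine counit_convMul (fun x y ↦ Bialgebra.counit_mul x y) (fun x y ↦ ?_) x y
  refine (counit_actOp M.left (HopfAlgebra.antipode k x) y).trans ?_
  rw [HopfAlgebra.counit_antipode]

lemma comul_antipode (x : H) : comul (R := k) (HopfAlgebra.antipode k x) =
    TensorProduct.map (HopfAlgebra.antipode k) (HopfAlgebra.antipode k)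
      (TensorProduct.comm k H H (comul x)) := by
  have h := congr($(push_comul_invHom (CoalgHom.id k H)) x)
  rw [convRight_mul_convLeft] at h
  exact h

lemma toConvHom_right : toConvHom M.right = rightOf M.left := eq_rightOf M.toConvHom_mul_right

/-- The commutation condition follows from `↼` and `•` being coalgebra morphisms. -/
lemma left_tmul_right (x y : H) :
    TensorProduct.map M.left.toLinearMap (rightOf M.left).ofConv (comul (R := k) (x ⊗ₜ[k] y)) =
      TensorProduct.map M.left.toLinearMap (rightOf M.left).ofConv
        (TensorProduct.comm k (H ⊗[k] H) (H ⊗[k] H) (comul (R := k) (x ⊗ₜ[k] y))) := by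
  revert x y
  rw [forall_comm_iff, comm_swap_iff, ← toConvHom_right]
  -- compare the expansions of `Δ (L * R)` and of `Δ` of the multiplication
  have h := congr(push (Bialgebra.comulAlgHom k H) $(M.toConvHom_mul_right))
  rw [map_mul, push_comul_toConvHom, push_comul_toConvHom, push_comul_toConvHom,
    ← toConvHom_mul_right, map_mul, map_mul] at h
  have h' := congr(push Algebra.TensorProduct.includeLeft (invHom M.left) * $h *
    push Algebra.TensorProduct.includeRight (invHom M.right))
  simp only [mul_assoc] at h'
  rw [← map_mul, mul_invHom, map_one, mul_one, ← mul_assoc, ← map_mul, invHom_mul, map_one,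
    one_mul, mul_one, ← mul_assoc, ← map_mul, invHom_mul, map_one, one_mul] at h'
  exact h'

/-- The Yetter--Drinfeld post-Hopf algebra of a matched pair of actions. -/
def postHopf : @YDPostHopfStruct k H _ M.isAlgMul_dot.ring M.isAlgMul_dot.algebra _ :=
  M.isAlgMul_dot.postHopf M.left M.beta.ofConv M.dotAntipode (mulOp k H).ofConv
    M.dotOp_mul_actOp M.dot_mul_antipode M.antipode_mul_dot M.act_mul_conv
    (fun x y z ↦ (M.mul_left x y z).symm) M.actOp_mul_beta M.beta_mul_actOp M.counit_dotOp
    Bialgebra.counit_one Bialgebra.comul_one M.comul_comp_dotOp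
    (by
      rw [beta_dotAntipode]
      exact comul_antipode)
    (by
      rw [beta_dotAntipode]
      exact M.left_tmul_right)

end MatchedPairStruct

/-! ### The isomorphism of categories -/

section Morphisms

variable {k : Type u} {H K : Type v} [Field k]

/-- A coalgebra morphism that intertwines two pairs of families of endomorphisms intertwines their
convolution products. -/
lemma map_convMul [AddCommGroup H] [Module k H] [Coalgebra k H] [AddCommGroup K] [Module k K]
    [Coalgebra k K] (g : H →ₗc[k] K) {F F' : WithConv (H →ₗ[k] Module.End k H)}
    {G G' : WithConv (K →ₗ[k] Module.End k K)} (h : ∀ x y, g (F x y) = G (g x) (g y))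
    (h' : ∀ x y, g (F' x y) = G' (g x) (g y)) (x y : H) :
    g ((F * F') x y) = (G * G') (g x) (g y) := by
  have e := comp_convMul_eq (δ := g.toLinearMap) (G := pull g G) (G' := pull g G')
    (fun x ↦ LinearMap.ext (h x)) (fun x ↦ LinearMap.ext (h' x)) x
  rw [← map_mul] at e
  exact congr($e y)

section Hopf

variable [Ring H] [HopfAlgebra k H] [Ring K] [HopfAlgebra k K]

lemma map_antipode (g : H →ₐc[k] K) (x : H) :
    g (HopfAlgebra.antipode k x) = HopfAlgebra.antipode k (g x) := by
  have h : push (g : H →ₐ[k] K) (toConv (HopfAlgebra.antipode k)) =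
      pull (g : H →ₗc[k] K) (toConv (HopfAlgebra.antipode k)) := by
    refine left_inv_eq_right_inv (a := push (g : H →ₐ[k] K) (toConv LinearMap.id)) ?_ ?_
    · rw [← map_mul, LinearMap.antipode_mul_id, map_one]
    · exact (map_mul (pull (g : H →ₗc[k] K)) (toConv LinearMap.id) _).symm.trans
        (by rw [LinearMap.id_mul_antipode, map_one])
  exact congr($h x)

/-- A bialgebra morphism that commutes with the left actions commutes with the right actions. -/
lemma map_right_of_map_left {M : MatchedPairStruct k H} {N : MatchedPairStruct k K}
    (g : H →ₐc[k] K) (h : ∀ a b, g (M.left (a ⊗ₜ b)) = N.left (g a ⊗ₜ g b)) (a b : H) :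
    g (M.right (a ⊗ₜ b)) = N.right (g a ⊗ₜ g b) := by
  let gg : H ⊗[k] H →ₗc[k] K ⊗[k] K := Coalgebra.TensorProduct.map (g : H →ₗc[k] K) g
  have hl : push (g : H →ₐ[k] K) (toConvHom M.left) = pull gg (toConvHom N.left) :=
    conv_ext_tmul h
  have hm : push (g : H →ₐ[k] K) (toConvHom (Bialgebra.mulCoalgHom k H)) =
      pull gg (toConvHom (Bialgebra.mulCoalgHom k K)) :=
    conv_ext_tmul fun x y ↦ map_mul g x y
  have hr : push (g : H →ₐ[k] K) (toConvHom M.right) = pull gg (toConvHom N.right) := by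
    refine toConvHom_left_cancel (f := N.left.comp gg) ?_
    change pull gg (toConvHom N.left) * _ = pull gg (toConvHom N.left) * _
    rw [← hl, ← map_mul, M.toConvHom_mul_right, hm, hl, ← map_mul, N.toConvHom_mul_right]
  exact congr($hr (a ⊗ₜ b))

lemma map_dotOp {M : MatchedPairStruct k H} {N : MatchedPairStruct k K}
    (g : H →ₐc[k] K) (h : ∀ a b, g (M.left (a ⊗ₜ b)) = N.left (g a ⊗ₜ g b)) (x y : H) :
    g (M.dotOp x y) = N.dotOp (g x) (g y) := by
  refine map_convMul (F := mulOp k H) (G := mulOp k K) (g : H →ₗc[k] K) (map_mul g)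
    (fun x y ↦ ?_) x y
  refine (h _ _).trans ?_
  rw [map_antipode]
  rfl

end Hopf

lemma map_bulletOp [Ring H] [Algebra k H] [Coalgebra k H] [Ring K] [Algebra k K] [Coalgebra k K]
    {X : YDPostHopfStruct k H} {Y : YDPostHopfStruct k K} (g : H →ₐc[k] K)
    (h : ∀ a b, g (X.act (a ⊗ₜ b)) = Y.act (g a ⊗ₜ g b)) (x y : H) :
    g (X.bulletOp x y) = Y.bulletOp (g x) (g y) :=
  map_convMul (F := mulOp k H) (F' := actOp X.act) (G := mulOp k K) (G' := actOp Y.act)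
    (g : H →ₗc[k] K) (map_mul g) h x y

end Morphisms

section Uniqueness

variable {k : Type u} [Field k]

/-- The antipode and the map `β` of a Yetter--Drinfeld post-Hopf algebra are determined by the
other data, as convolution inverses. -/
lemma YDPostHopfStruct.ext_act {H : Type v} [Ring H] [Algebra k H] [Coalgebra k H]
    {X Y : YDPostHopfStruct k H} (h : X.act = Y.act) : X = Y := by
  refine YDPostHopfStruct.ext ?_ h ?_
  · exact congr(($(left_inv_eq_right_inv ((antipode_convMul_iff _).1 X.antipode_mul)
      ((convMul_antipode_iff _).1 Y.mul_antipode))).ofConv)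
  · have hX := X.beta_mul_actOp
    rw [h] at hX
    exact congr(($(left_inv_eq_right_inv hX Y.actOp_mul_beta)).ofConv)

lemma MatchedPairStruct.ext_left {H : Type v} [Ring H] [HopfAlgebra k H]
    {M N : MatchedPairStruct k H} (h : M.left = N.left) : M = N := by
  refine MatchedPairStruct.ext h ?_
  have e : toConvHom M.right = toConvHom N.right := by
    rw [M.toConvHom_right, N.toConvHom_right, h]
  exact CoalgHom.ext fun x ↦ congr($e x)

lemma algebra_heq {H : Type v} {r₁ r₂ : Ring H} (hr : r₁ = r₂)
    {a₁ : @Algebra k H _ r₁.toSemiring} {a₂ : @Algebra k H _ r₂.toSemiring}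
    (h : ∀ c : k, @algebraMap k H _ _ a₁ c = @algebraMap k H _ _ a₂ c) : HEq a₁ a₂ := by
  subst hr
  exact heq_of_eq (Algebra.algebra_ext a₁ a₂ h)

/-- A Hopf algebra is determined by the underlying algebra and coalgebra. -/
lemma hopfAlgebra_heq {H : Type v} {r₁ r₂ : Ring H} (hr : r₁ = r₂)
    {h₁ : @HopfAlgebra k H _ r₁.toSemiring} {h₂ : @HopfAlgebra k H _ r₂.toSemiring}
    (ha : HEq h₁.toAlgebra h₂.toAlgebra) (hc : HEq h₁.toCoalgebra h₂.toCoalgebra) :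
    HEq h₁ h₂ := by
  subst hr
  obtain @⟨@⟨b₁, S₁⟩, p₁, q₁⟩ := h₁
  obtain @⟨@⟨b₂, S₂⟩, p₂, q₂⟩ := h₂
  obtain rfl : b₁ = b₂ := by
    obtain @⟨a₁, c₁, _⟩ := b₁
    obtain @⟨a₂, c₂, _⟩ := b₂
    obtain rfl : a₁ = a₂ := eq_of_heq ha
    obtain rfl : c₁ = c₂ := eq_of_heq hc
    rfl
  obtain rfl : S₁ = S₂ :=
    congr(($(left_inv_eq_right_inv (a := toConv LinearMap.id) (b := toConv S₁) (c := toConv S₂)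
      (WithConv.ext p₁) (WithConv.ext q₂))).ofConv)
  rfl

lemma YDPostHopfAlg.eq_of_heq {A B : YDPostHopfAlg.{v} k} (h : A.carrier = B.carrier)
    (hr : HEq A.ring B.ring) (ha : HEq A.algebra B.algebra) (hc : HEq A.coalgebra B.coalgebra)
    (hX : HEq A.str.act B.str.act) : A = B := by
  obtain @⟨H, r, a, c, X⟩ := A
  obtain @⟨H', r', a', c', X'⟩ := B
  obtain rfl : H = H' := h
  obtain rfl : r = r' := _root_.eq_of_heq hr
  obtain rfl : a = a' := _root_.eq_of_heq ha
  obtain rfl : c = c' := _root_.eq_of_heq hc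
  obtain rfl : X = X' := YDPostHopfStruct.ext_act (_root_.eq_of_heq hX)
  rfl

lemma MatchedPair.eq_of_heq {M N : MatchedPair.{v} k} (h : M.carrier = N.carrier)
    (hr : HEq M.ring N.ring) (hh : HEq M.hopfAlgebra N.hopfAlgebra)
    (hX : HEq M.str.left N.str.left) : M = N := by
  obtain @⟨H, r, a, X⟩ := M
  obtain @⟨H', r', a', X'⟩ := N
  obtain rfl : H = H' := h
  obtain rfl : r = r' := _root_.eq_of_heq hr
  obtain rfl : a = a' := _root_.eq_of_heq hh
  obtain rfl : X = X' := MatchedPairStruct.ext_left (_root_.eq_of_heq hX)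
  rfl

end Uniqueness

section RoundTrip

variable {k : Type u} {H : Type v} [Field k] [Ring H]

lemma YDPostHopfStruct.matchedPair_dotOp [Algebra k H] [Coalgebra k H]
    (X : YDPostHopfStruct k H) :
    @MatchedPairStruct.dotOp k H _ X.bulletRing X.bulletHopf X.matchedPair = mulOp k H := by
  let D : WithConv (H →ₗ[k] Module.End k H) :=
    @MatchedPairStruct.dotOp k H _ X.bulletRing X.bulletHopf X.matchedPair
  have hD : D * actOp X.act = X.bulletOp :=
    @MatchedPairStruct.dotOp_mul_actOp k H _ X.bulletRing X.bulletHopf X.matchedPair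
  change D = mulOp k H
  rw [← X.bulletOp_mul_beta, ← hD, mul_assoc, X.actOp_mul_beta, mul_one]

lemma MatchedPairStruct.postHopf_bulletOp [HopfAlgebra k H] (M : MatchedPairStruct k H) :
    @YDPostHopfStruct.bulletOp k H _ M.isAlgMul_dot.ring M.isAlgMul_dot.algebra _ M.postHopf =
      mulOp k H :=
  M.dotOp_mul_actOp

end RoundTrip

section Categories

variable {k : Type u} [Field k]

/-- The matched pair of actions `(H_⇀, ⇀, ↼)`. -/
def matchedPairObj (A : YDPostHopfAlg.{v} k) : MatchedPair.{v} k :=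
  @MatchedPair.mk k _ A.carrier A.str.bulletRing A.str.bulletHopf A.str.matchedPair

/-- The Yetter--Drinfeld post-Hopf algebra of a matched pair of actions. -/
def postHopfObj (M : MatchedPair.{v} k) : YDPostHopfAlg.{v} k :=
  @YDPostHopfAlg.mk k _ M.carrier M.str.isAlgMul_dot.ring M.str.isAlgMul_dot.algebra _
    M.str.postHopf

variable (k) in
/-- The functor from Yetter--Drinfeld post-Hopf algebras to matched pairs of actions. -/
def matchedPairFunctor : YDPostHopfAlg.{v} k ⥤ MatchedPair.{v} k where
  obj := matchedPairObj
  map {A B} f :=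
    let g : (matchedPairObj A).carrier →ₐc[k] (matchedPairObj B).carrier :=
      BialgHom.mk (YDPostHopfAlg.Hom.hom f : A.carrier →ₗc[k] B.carrier)
        (map_one (YDPostHopfAlg.Hom.hom f))
        (map_bulletOp (YDPostHopfAlg.Hom.hom f) (YDPostHopfAlg.Hom.map_act f))
    MatchedPair.Hom.mk (M := matchedPairObj A) (N := matchedPairObj B) g
      (YDPostHopfAlg.Hom.map_act f)
      (map_right_of_map_left g (YDPostHopfAlg.Hom.map_act f))

variable (k) in
/-- The functor from matched pairs of actions to Yetter--Drinfeld post-Hopf algebras. -/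
def postHopfFunctor : MatchedPair.{v} k ⥤ YDPostHopfAlg.{v} k where
  obj := postHopfObj
  map {M N} f :=
    let g : (postHopfObj M).carrier →ₐc[k] (postHopfObj N).carrier :=
      BialgHom.mk (MatchedPair.Hom.hom f : M.carrier →ₗc[k] N.carrier)
        (map_one (MatchedPair.Hom.hom f))
        (map_dotOp (MatchedPair.Hom.hom f) (MatchedPair.Hom.map_left f))
    YDPostHopfAlg.Hom.mk (A := postHopfObj M) (B := postHopfObj N) g (MatchedPair.Hom.map_left f)

instance : (YDPostHopfAlg.toCoalg.{v} (k := k)).Faithful where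
  map_injective {A B} f g h := by
    refine YDPostHopfAlg.Hom.ext (BialgHom.ext fun x ↦ ?_)
    exact congr(CoalgCat.Hom.toCoalgHom $h x)

instance : (MatchedPair.toCoalg.{v} (k := k)).Faithful where
  map_injective {A B} f g h := by
    refine MatchedPair.Hom.ext (BialgHom.ext fun x ↦ ?_)
    exact congr(CoalgCat.Hom.toCoalgHom $h x)

/-- Functors that agree on objects and after composition with a faithful functor are equal. -/
lemma functor_eq_of_comp_faithful {C D E : Type*} [Category* C] [Category* D] [Category* E]
    {F G : C ⥤ D} (U : D ⥤ E) [U.Faithful] (hobj : ∀ X, F.obj X = G.obj X)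
    (h : F ⋙ U = G ⋙ U) : F = G := by
  refine CategoryTheory.Functor.ext hobj fun X Y f ↦ U.map_injective ?_
  have e := Functor.congr_hom h f
  simpa [eqToHom_map] using e

lemma postHopfObj_matchedPairObj (A : YDPostHopfAlg.{v} k) :
    postHopfObj (matchedPairObj A) = A := by
  have hr : (postHopfObj (matchedPairObj A)).ring = A.ring :=
    Ring.ext rfl (funext₂ fun x y ↦ congr($(A.str.matchedPair_dotOp) x y))
  refine YDPostHopfAlg.eq_of_heq rfl (heq_of_eq hr)
    (algebra_heq hr fun c ↦ (Algebra.algebraMap_eq_smul_one (A := A.carrier) c).symm) HEq.rfl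
    HEq.rfl

lemma matchedPairObj_postHopfObj (M : MatchedPair.{v} k) :
    matchedPairObj (postHopfObj M) = M := by
  have hr : (matchedPairObj (postHopfObj M)).ring = M.ring :=
    Ring.ext rfl (funext₂ fun x y ↦ congr($(M.str.postHopf_bulletOp) x y))
  refine MatchedPair.eq_of_heq rfl (heq_of_eq hr) (hopfAlgebra_heq hr
    (algebra_heq hr fun c ↦ (Algebra.algebraMap_eq_smul_one (A := M.carrier) c).symm) HEq.rfl)
    HEq.rfl

lemma isMatchedPairOf_matchedPairObj (A : YDPostHopfAlg.{v} k) :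
    IsMatchedPairOf A (matchedPairObj A) := by
  refine ⟨rfl, fun x y ↦ ?_, rfl, fun x ↦ rfl, fun x y ↦ rfl, fun x y ↦ ?_⟩
  · exact (A.str.bulletOp_apply x y).symm
  · refine congr($(A.str.rightAct_eq) (x ⊗ₜ y)).trans ?_
    exact congr($(A.str.isHopfMul_bullet.rightOf_eq A.str.act) (x ⊗ₜ y)).symm

lemma isPostHopfOf_postHopfObj (M : MatchedPair.{v} k) :
    IsPostHopfOf M (postHopfObj M) := by
  refine ⟨rfl, fun x y ↦ ?_, rfl, fun x ↦ ?_, fun x y ↦ rfl⟩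
  · change LinearMap.mul' k M.carrier _ = M.str.dotOp x y
    rw [MatchedPairStruct.dotOp, LinearMap.convMul_apply]
    induction comul (R := k) x with
    | zero => simp
    | add a b ha hb => simp only [map_add, LinearMap.add_apply, ha, hb]
    | tmul a b => rfl
  · change M.str.left _ = M.str.dotAntipode x
    simp only [MatchedPairStruct.dotAntipode, bconv, LinearMap.comp_apply]
    induction comul (R := k) x with
    | zero => simp
    | add a b ha hb => simp only [map_add, ha, hb]
    | tmul a b => rfl

end Categories

end

end YDPostHopf

theorem mainTheorem7 (k : Type u) [Field k] :
    ∃ e : IsoCat (YDPostHopf.YDPostHopfAlg.{v} k) (YDPostHopf.MatchedPair.{v} k),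
      e.functor ⋙ YDPostHopf.MatchedPair.toCoalg = YDPostHopf.YDPostHopfAlg.toCoalg ∧
      e.inverse ⋙ YDPostHopf.YDPostHopfAlg.toCoalg = YDPostHopf.MatchedPair.toCoalg ∧
      (∀ A : YDPostHopf.YDPostHopfAlg.{v} k, YDPostHopf.IsMatchedPairOf A (e.functor.obj A)) ∧
      (∀ M : YDPostHopf.MatchedPair.{v} k, YDPostHopf.IsPostHopfOf M (e.inverse.obj M)) := by
  refine ⟨⟨YDPostHopf.matchedPairFunctor k, YDPostHopf.postHopfFunctor k, ?_, ?_⟩,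
    rfl, rfl, YDPostHopf.isMatchedPairOf_matchedPairObj,
    YDPostHopf.isPostHopfOf_postHopfObj⟩
  · refine (YDPostHopf.functor_eq_of_comp_faithful
      (F := YDPostHopf.matchedPairFunctor k ⋙ YDPostHopf.postHopfFunctor k) (G := 𝟭 _)
      YDPostHopf.YDPostHopfAlg.toCoalg YDPostHopf.postHopfObj_matchedPairObj rfl).symm
  · exact YDPostHopf.functor_eq_of_comp_faithful
      (F := YDPostHopf.postHopfFunctor k ⋙ YDPostHopf.matchedPairFunctor k) (G := 𝟭 _)
      YDPostHopf.MatchedPair.toCoalg YDPostHopf.matchedPairObj_postHopfObj rfl
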